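/- Let $G$ be a second countable locally compact Hausdorff group, $S\le G$ a closed amenable subgroup, $dg$ and $ds$ left Haar measures on $G$ and $S$, and $\Delta_G,\Delta_S$ the modular functions, normalised by $\int_G f(gh)\,dg=\Delta_G(h)^{-1}\int_G f(g)\,dg$ (similarly for $S$). Put $\Delta_{G,S}(s)=\Delta_G(s)/\Delta_S(s)$ for $s\in S$ and $H=G/S$. Let $\sigma:H\to G$ be a Borel cross-section ($\sigma(x)\in x$ for all $x\in H$) mapping compact sets to relatively compact sets, and let $dx$ be the Radon measure on $H$ determined by $$\int_G f(g)\,dg=\int_H\int_S f(\sigma(x)s)\,\Delta_{G,S}(s)\,ds\,dx\qquad\text{for all Borel } f\ge 0 .$$ For $g\in G$ and $y\in H$ write $g^{-1}\sigma(y)=\sigma(\eta(g,y))\,\tau(g,y)$ with $\eta(g,y)\in H$, $\tau(g,y)\in S$. Let $1\le p<\infty$, let $X$ be a complex Banach space, and let $\rho$ be a strongly continuous isometric representation of $S$ on $X$. Assume that $X$ has a dense $\rho$-invariant linear subspace $X_0$ and an injective antilinear map $i:X_0\to X^*$ such that, with $\langle x,v\rangle:=i(v)(x)$, $$\|x\|=\sup\{|\langle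 x,v\rangle| : v\in X_0,\ \|i(v)\|=1\},\qquad \|i(\rho(s)v)\|=\|i(v)\|,\qquad \langle\rho(s)x,\rho(s)v\rangle=\langle x,v\rangle$$ for all $x\in X$, $v\in X_0$, $s\in S$ (the supremum being $0$ if $X=\{0\}$). Let $\pi_p$ be the $p$-induced representation of $G$ on $L^p(H,X)$, $$[\pi_p(g)\xi](y)=\Delta_{G,S}(\tau(g,y))^{-1/p}\,\rho(\tau(g,y)^{-1})[\xi(\eta(g,y))],$$ and let $\lambda_G$ be the left-regular representation, $[\lambda_G(g)f](g')=f(g^{-1}g')$, on $L^p(G,X)$ or on $L^p(G)$. For a bounded complex Borel measure $\mu$ on $G$ put $\pi_p(\mu)=\int_G\pi_p(g)\,d\mu(g)$ and $\lambda_G(\mu)=\int_G\lambda_G(g)\,d\mu(g)$; that is, $[\pi_p(\mu)\xi](y)=\int_G[\pi_p(g)\xi](y)\,d\mu(g)$ for almost every $y$, the integral being absolutely convergent, and similarly for $\lambda_G(\mu)$. Then, for every bounded complex measure $\mu$ on $G$, $\pi_p(\mu)$ and $\lambda_G(\mu)$ are well-defined bounded operators, and: (1) $\|\pi_p(\mu)\|_{L^p(H,X)\to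 L^p(H,X)}\le\|\lambda_G(\mu)\|_{L^p(G,X)\to L^p(G,X)}$. (2) If $X=L^p(\Omega)$ for a measure space $\Omega$ (with the same $p$), then moreover $$\|\lambda_G(\mu)\|_{L^p(G,X)\to L^p(G,X)}\le\|\lambda_G(\mu)\|_{L^p(G)\to L^p(G)},$$ and hence $\|\pi_p(\mu)\|_{L^p(H,L^p(\Omega))\to L^p(H,L^p(\Omega))}\le\|\lambda_G(\mu)\|_{L^p(G)\to L^p(G)}$. -/

import Mathlib

open MeasureTheory
open scoped ENNReal NNReal BoundedContinuousFunction

noncomputable section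

namespace PInduced

universe u v

/-- A topological group `K` is amenable: there is a left-invariant mean on the space of bounded
continuous real functions on `K`. -/
def IsAmenable (K : Type u) [Group K] [TopologicalSpace K] [IsTopologicalGroup K] : Prop :=
  ∃ m : (K →ᵇ ℝ) →ₗ[ℝ] ℝ,
    (∀ f : K →ᵇ ℝ, 0 ≤ f → 0 ≤ m f) ∧ m 1 = 1 ∧
      ∀ (k : K) (f : K →ᵇ ℝ),
        m (f.compContinuous ⟨fun x => k * x, continuous_const_mul k⟩) = m f

/-- The modular function `Δ_K`, normalised by `∫ f (g h) dg = Δ_K(h)⁻¹ ∫ f (g) dg` for the left Haar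
measure `dg` (see `lintegral_mul_right`); Mathlib's `modularCharacter` is its inverse. -/
def modularFn {K : Type u} [Group K] [TopologicalSpace K] [IsTopologicalGroup K]
    [LocallyCompactSpace K] (h : K) : ℝ≥0 :=
  (Measure.modularCharacter h)⁻¹

theorem lintegral_mul_right {K : Type u} [Group K] [TopologicalSpace K] [IsTopologicalGroup K]
    [LocallyCompactSpace K] [SecondCountableTopology K] [T2Space K] [MeasurableSpace K]
    [BorelSpace K] (m : Measure K) [m.IsHaarMeasure] (h : K) (f : K → ℝ≥0∞) (hf : Measurable f) :
    ∫⁻ g, f (g * h) ∂m = ((modularFn h)⁻¹ : ℝ≥0) * ∫⁻ g, f g ∂m := by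
  have key := Measure.map_right_mul_eq_modularCharacterFun_smul m h
  rw [← lintegral_map hf (measurable_mul_const h), key]
  rw [lintegral_smul_measure, modularFn, inv_inv]
  rfl

instance closedSubgroup_locallyCompact {G : Type u} [Group G] [TopologicalSpace G]
    [LocallyCompactSpace G] (S : Subgroup G) [hS : IsClosed (S : Set G)] :
    LocallyCompactSpace S :=
  hS.isClosedEmbedding_subtypeVal.locallyCompactSpace

section Setup

variable {G : Type u} [Group G] [TopologicalSpace G] [IsTopologicalGroup G]
  [LocallyCompactSpace G] [MeasurableSpace G]

/-- `Δ_{G,S}(s) = Δ_G(s) / Δ_S(s)`. -/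
def modularRatio (S : Subgroup G) [IsClosed (S : Set G)] (s : S) : ℝ≥0 :=
  modularFn (s : G) / modularFn s

/-- A Borel cross-section `σ : G/S → G` which maps compact sets to relatively compact sets.
(`G ⧸ S` carries the quotient `σ`-algebra, which is its Borel `σ`-algebra when `G` is a
second countable locally compact Hausdorff group and `S` is closed.) -/
structure CrossSection (S : Subgroup G) where
  toFun : G ⧸ S → G
  mk_toFun : ∀ x : G ⧸ S, ((toFun x : G) : G ⧸ S) = x
  measurable_toFun : Measurable toFun
  isCompact_closure_image : ∀ K : Set (G ⧸ S), IsCompact K → IsCompact (closure (toFun '' K))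

variable {S : Subgroup G}

/-- The `S`-component `τ(g)` in the decomposition `g = σ(η(g)) τ(g)`, where `η(g) = gS`. -/
def CrossSection.tau (σ : CrossSection S) (g : G) : S :=
  ⟨(σ.toFun (g : G ⧸ S))⁻¹ * g, QuotientGroup.eq.mp (σ.mk_toFun (g : G ⧸ S))⟩

/-- `τ(g, x) = τ(g⁻¹ σ(x))`. -/
def CrossSection.tau₂ (σ : CrossSection S) (g : G) (x : G ⧸ S) : S :=
  σ.tau (g⁻¹ * σ.toFun x)

/-- `η(g, x) = η(g⁻¹ σ(x))`, the coset of `g⁻¹ σ(x)`. -/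
def CrossSection.eta₂ (σ : CrossSection S) (g : G) (x : G ⧸ S) : G ⧸ S :=
  ((g⁻¹ * σ.toFun x : G) : G ⧸ S)

/-- `ν` is the Radon measure `dx` on `G/S` determined by the Haar measures `dg`, `ds` and by `σ`:
`∫_G f(g) dg = ∫_{G/S} ∫_S f(σ(x) s) Δ_{G,S}(s) ds dx`. -/
structure IsQuotientMeasure [IsClosed (S : Set G)] (σ : CrossSection S) (mG : Measure G)
    (mS : Measure S) (ν : Measure (G ⧸ S)) : Prop where
  finite_of_isCompact : ∀ K : Set (G ⧸ S), IsCompact K → ν K < ∞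
  lintegral_eq : ∀ f : G → ℝ≥0∞, Measurable f →
    ∫⁻ g, f g ∂mG =
      ∫⁻ x, ∫⁻ s : S, f (σ.toFun x * (s : G)) * (modularRatio S s : ℝ≥0∞) ∂mS ∂ν

variable {X : Type v} [NormedAddCommGroup X] [NormedSpace ℂ X]

/-- The standing assumption on `X`: `X₀` is a dense `ρ`-invariant subspace with an antilinear
embedding `i` into the dual of `X`, norming for `X` and compatible with `ρ`. -/
structure IsNormingEmbedding (ρ : S →* (X ≃ₗᵢ[ℂ] X)) (X₀ : Submodule ℂ X)
    (i : X₀ →ₛₗ[starRingEnd ℂ] StrongDual ℂ X) : Prop where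
  dense : Dense (X₀ : Set X)
  invariant : ∀ (s : S) (v : X₀), ρ s (v : X) ∈ X₀
  injective : Function.Injective i
  norm_eq : ∀ x : X, ‖x‖ = ⨆ v : {v : X₀ // ‖i v‖ = 1}, ‖i v x‖
  norm_map : ∀ (s : S) (v : X₀), ‖i ⟨ρ s (v : X), invariant s v⟩‖ = ‖i v‖
  pairing_map : ∀ (s : S) (x : X) (v : X₀), i ⟨ρ s (v : X), invariant s v⟩ (ρ s x) = i v x

/-- The `p`-induced representation `π_p`, realised on functions on `G/S`:
`[π_p(g)ξ](y) = Δ_{G,S}(τ(g,y))^{-1/p} ρ(τ(g,y)⁻¹)[ξ(η(g,y))]`. -/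
def inducedRep [IsClosed (S : Set G)] (σ : CrossSection S) (ρ : S →* (X ≃ₗᵢ[ℂ] X)) (p : ℝ≥0∞)
    (g : G) (ξ : G ⧸ S → X) (y : G ⧸ S) : X :=
  (((modularRatio S (σ.tau₂ g y) : ℝ) ^ (-(1 / p.toReal)) : ℝ) : ℂ) •
    ρ (σ.tau₂ g y)⁻¹ (ξ (σ.eta₂ g y))

end Setup

/-- The left-regular representation `[λ_G(g)f](g') = f(g⁻¹ g')` on `X`-valued functions. -/
def leftRegular {G : Type u} [Group G] {X : Type v} (g : G) (f : G → X) (g' : G) : X := f (g⁻¹ * g')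

/-- `T` is the operator `∫_G π(g) dμ(g)` on `L^p(Y, ν; X)` integrating the representation `π`, given
by its action on functions, against the complex measure `μ`: for `ξ` in `L^p`, for almost every `y`
the function `g ↦ [π(g)ξ](y)` is `|μ|`-integrable and `(T ξ)(y) = ∫_G [π(g)ξ](y) dμ(g)`. -/
def IsIntegratedForm {G : Type u} [MeasurableSpace G] {X : Type v} [NormedAddCommGroup X]
    [NormedSpace ℂ X] {Y : Type*} [MeasurableSpace Y] (π : G → (Y → X) → Y → X)
    (μ : ComplexMeasure G) (p : ℝ≥0∞) [Fact (1 ≤ p)] (ν : Measure Y)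
    (T : Lp X p ν →L[ℂ] Lp X p ν) : Prop :=
  ∀ (ξ : Y → X) (hξ : MemLp ξ p ν), ∀ᵐ y ∂ν,
    μ.Integrable (fun g => π g ξ y) ∧
      T (hξ.toLp ξ) y =
        μ.integral (fun g => π g ξ y) (ContinuousLinearMap.lsmul ℝ ℂ).flip

theorem IsIntegratedForm.unique {G : Type u} [MeasurableSpace G] {X : Type v} [NormedAddCommGroup X]
    [NormedSpace ℂ X] {Y : Type*} [MeasurableSpace Y] {π : G → (Y → X) → Y → X}
    {μ : ComplexMeasure G} {p : ℝ≥0∞} [Fact (1 ≤ p)] {ν : Measure Y}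
    {T T' : Lp X p ν →L[ℂ] Lp X p ν} (h : IsIntegratedForm π μ p ν T)
    (h' : IsIntegratedForm π μ p ν T') : T = T' := by
  ext1 ξ
  apply Lp.ext
  filter_upwards [h ξ (Lp.memLp ξ), h' ξ (Lp.memLp ξ)] with y hy hy'
  rw [← Lp.toLp_coeFn ξ (Lp.memLp ξ), hy.2, hy'.2]

end PInduced

end

/-! The proof is a transference argument. Write `Δ` for `modularRatio S` and `π` for the induced
representation. Both integrated forms exist because `π` and the left-regular representation act by
isometries of `L^p`: Hölder's inequality for the variation of `μ`, followed by Tonelli, bounds the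
integral by the total mass of `μ` (`integratedForm`). For `π`, isometry comes from the change of
variables `lintegral_flow` on `G ⧸ S`.

For the first inequality, let `f ≥ 0` have integral one on `S` and put `φ = f^(1/p)`. Extending `ξ`
equivariantly to `G` and cutting off by `φ` along the fibres gives `F` with the same `L^p` norm as
`ξ`. In the coordinates `σ(x) s`, and up to a twist by `s` that `Δ` absorbs, `λ(μ)F` becomes `A(x,s)
= ∫ φ(τ(k,x)s) [π(k)ξ](x) dμ(k)`. If `φ(τ(k,x)s)` is replaced by `φ(s)`, the result is `B(x,s) =
φ(s) [π(μ)ξ](x)`, whose norm is that of `π(μ)ξ`. The error `B - A` is controlled by the `L¹`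
distances between `f` and its translates by `τ(k,x)` (`enorm_le_of_isIntegratedForm`). Amenability
makes these small on compact sets (`exists_reiter`), and the mass of `τ(k,x)` outside a large
compact set is negligible.

For the second inequality, `λ(μ)` on `L^p(G, L^p(Ω))` is `λ(μ) ⊗ 1`. Since both exponents equal `p`,
Tonelli allows the scalar bound to be applied for each point of `Ω` (`norm_le_of_pureTensor`). -/

noncomputable section

set_option linter.unusedSectionVars false

namespace PInduced

/-! ### Vector-valued integration against a complex measure. -/

section ComplexIntegral

variable {α : Type*} [MeasurableSpace α] (μ : ComplexMeasure α)
  {X : Type*} [NormedAddCommGroup X] [NormedSpace ℂ X]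

/-- The integral of a vector-valued function against a complex measure. -/
abbrev cintegral (f : α → X) : X := μ.integral f (ContinuousLinearMap.lsmul ℝ ℂ).flip

/-- The variation is dominated by the sum of the total variations of the real and imaginary parts,
which are finite signed measures. -/
instance isFiniteMeasure_variation : IsFiniteMeasure μ.variation := by
  have h : μ.variation ≤ (ComplexMeasure.re μ).totalVariation +
      (ComplexMeasure.im μ).totalVariation := by
    refine VectorMeasure.variation_le_of_forall_enorm_le fun s hs => ?_
    rw [Measure.add_apply]
    refine le_trans ?_ (add_le_add (SignedMeasure.enorm_le_totalVariation _ s)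
      (SignedMeasure.enorm_le_totalVariation _ s))
    have h1 : μ s = ((ComplexMeasure.re μ s : ℝ) : ℂ) +
        ((ComplexMeasure.im μ s : ℝ) : ℂ) * Complex.I := (Complex.re_add_im (μ s)).symm
    rw [h1]
    refine (enorm_add_le _ _).trans (le_of_eq ?_)
    simp [enorm_eq_nnnorm]
  exact isFiniteMeasure_of_le _ h

theorem norm_lsmul_flip_le :
    ‖((ContinuousLinearMap.lsmul ℝ ℂ).flip : X →L[ℝ] ℂ →L[ℝ] X)‖ₑ ≤ 1 := by
  have : ‖((ContinuousLinearMap.lsmul ℝ ℂ).flip : X →L[ℝ] ℂ →L[ℝ] X)‖ ≤ 1 := by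
    refine ContinuousLinearMap.opNorm_le_bound₂ _ zero_le_one fun x c => ?_
    simp [norm_smul, mul_comm]
  rw [← ofReal_norm, ← ENNReal.ofReal_one]
  exact ENNReal.ofReal_le_ofReal this

theorem enorm_cintegral_le (f : α → X) : ‖cintegral μ f‖ₑ ≤ ∫⁻ a, ‖f a‖ₑ ∂μ.variation := by
  refine VectorMeasure.enorm_integral_le_lintegral_enorm.trans ?_
  exact (mul_le_mul_left norm_lsmul_flip_le _).trans (one_mul _).le

variable {μ}

theorem cintegral_add {f g : α → X} (hf : Integrable f μ.variation)
    (hg : Integrable g μ.variation) :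
    cintegral μ (fun a => f a + g a) = cintegral μ f + cintegral μ g :=
  VectorMeasure.integral_fun_add hf hg

theorem cintegral_sub {f g : α → X} (hf : Integrable f μ.variation)
    (hg : Integrable g μ.variation) :
    cintegral μ (fun a => f a - g a) = cintegral μ f - cintegral μ g :=
  VectorMeasure.integral_fun_sub hf hg

theorem cintegral_smul (c : ℂ) (f : α → X) :
    cintegral μ (fun a => c • f a) = c • cintegral μ f := by
  refine setToFun_smul _ (fun c s x => ?_) c f
  exact smul_comm (μ s) c x

theorem cintegral_indicator_const [CompleteSpace X] {s : Set α} (hs : MeasurableSet s) (x : X) :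
    cintegral μ (s.indicator fun _ => x) = μ s • x := by
  rw [cintegral, VectorMeasure.integral_indicator hs, VectorMeasure.integral_const]
  simp [VectorMeasure.restrict_apply _ hs]

/-- Integration against a complex measure commutes with complex-linear operators. -/
theorem cintegral_comp_clm {Z : Type*} [NormedAddCommGroup Z] [NormedSpace ℂ Z]
    [CompleteSpace X] [CompleteSpace Z]
    (A : X →L[ℂ] Z) {f : α → X} (hf : Integrable f μ.variation) :
    cintegral μ (fun a => A (f a)) = A (cintegral μ f) := by
  -- On indicators the claim is complex linearity of `A`. Both sides are continuous on `L¹` of the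
  -- variation, so it extends by density.
  refine Integrable.induction (μ := μ.variation)
    (fun f : α → X => cintegral μ (fun a => A (f a)) = A (cintegral μ f)) ?_ ?_ ?_ ?_ hf
  · intro c s hs _
    have : (fun a => A (s.indicator (fun _ => c) a)) = s.indicator fun _ => A c := by
      ext a; by_cases ha : a ∈ s <;> simp [ha]
    rw [this, cintegral_indicator_const hs, cintegral_indicator_const hs, map_smul]
  · intro f g _ hf hg hf' hg'
    simp only [Pi.add_apply, map_add]
    rw [cintegral_add (A.integrable_comp hf) (A.integrable_comp hg), hf', hg', ← map_add]
    congr 1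
    exact (cintegral_add hf hg).symm
  · have h1 : Continuous fun f : α →₁[μ.variation] X => A (cintegral μ f) :=
      A.continuous.comp VectorMeasure.continuous_integral
    have h2 : Continuous fun f : α →₁[μ.variation] X => cintegral μ (fun a => A (f a)) := by
      have : Continuous fun f : α →₁[μ.variation] X =>
          cintegral μ ((A.restrictScalars ℝ).compLpL 1 μ.variation f) :=
        VectorMeasure.continuous_integral.comp
          ((A.restrictScalars ℝ).compLpL 1 μ.variation).continuous
      refine this.congr fun f => ?_
      refine VectorMeasure.integral_congr_ae ?_
      exact (A.restrictScalars ℝ).coeFn_compLpL f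
    exact isClosed_eq h2 h1
  · intro f g hfg hf h
    have h1 : cintegral μ g = cintegral μ f := VectorMeasure.integral_congr_ae hfg.symm
    have h2 : cintegral μ (fun a => A (g a)) = cintegral μ (fun a => A (f a)) :=
      VectorMeasure.integral_congr_ae (hfg.symm.mono fun a ha => by simp only [ha])
    rw [h1, h2, h]

theorem stronglyMeasurable_cintegral {β : Type*} [MeasurableSpace β] (μ : ComplexMeasure α)
    {f : β → α → X}
    (hf : StronglyMeasurable (Function.uncurry f)) :
    StronglyMeasurable fun b => cintegral μ (f b) := by
  refine StronglyMeasurable.setToFun_prod_right _ (fun s hs => ?_) hf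
  have h := VectorMeasure.stronglyMeasurable_vectorMeasure_prodMk_left (ν := μ) hs
  exact (ContinuousLinearMap.continuous
    ((ContinuousLinearMap.lsmul ℝ ℂ).flip : X →L[ℝ] ℂ →L[ℝ] X).flip).comp_stronglyMeasurable h

theorem lintegral_enorm_rpow_le {E : Type*} [NormedAddCommGroup E] (m : Measure α) {f : α → E}
    (hf : AEStronglyMeasurable f m)
    {q : ℝ} (hq : 1 ≤ q) :
    (∫⁻ a, ‖f a‖ₑ ∂m) ^ q ≤ m Set.univ ^ (q - 1) * ∫⁻ a, ‖f a‖ₑ ^ q ∂m := by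
  have hq0 : 0 < q := by linarith
  have h := eLpNorm_le_eLpNorm_mul_rpow_measure_univ (μ := m) (p := 1) (q := ENNReal.ofReal q)
    (by simpa using hq) hf
  rw [eLpNorm_one_eq_lintegral_enorm, eLpNorm_eq_lintegral_rpow_enorm_toReal
    (by simpa using hq0) ENNReal.ofReal_ne_top, ENNReal.toReal_ofReal hq0.le] at h
  refine (ENNReal.rpow_le_rpow h hq0.le).trans (le_of_eq ?_)
  rw [ENNReal.mul_rpow_of_nonneg _ _ hq0.le, ← ENNReal.rpow_mul, ← ENNReal.rpow_mul]
  have e1 : 1 / q * q = 1 := by field_simp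
  have e2 : (1 / (1 : ℝ≥0∞).toReal - 1 / q) * q = q - 1 := by simp; field_simp
  rw [e1, e2, ENNReal.rpow_one, mul_comm]

theorem enorm_cintegral_rpow_le (μ : ComplexMeasure α) {f : α → X}
    (hf : AEStronglyMeasurable f μ.variation) {q : ℝ} (hq : 1 ≤ q) :
    ‖cintegral μ f‖ₑ ^ q ≤
      μ.variation Set.univ ^ (q - 1) * ∫⁻ a, ‖f a‖ₑ ^ q ∂μ.variation :=
  (ENNReal.rpow_le_rpow (enorm_cintegral_le μ f) (by linarith)).trans
    (lintegral_enorm_rpow_le _ hf hq)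

theorem integrable_of_lintegral_rpow_ne_top {E : Type*} [NormedAddCommGroup E]
    (m : Measure α) [IsFiniteMeasure m] {f : α → E}
    (hf : AEStronglyMeasurable f m) {q : ℝ} (hq : 1 ≤ q) (h : ∫⁻ a, ‖f a‖ₑ ^ q ∂m ≠ ∞) :
    Integrable f m := by
  refine ⟨hf, ?_⟩
  have h2 : (∫⁻ a, ‖f a‖ₑ ∂m) ^ q < ∞ := by
    refine (lintegral_enorm_rpow_le m hf hq).trans_lt (ENNReal.mul_lt_top ?_ h.lt_top)
    exact ENNReal.rpow_lt_top_of_nonneg (by linarith) (measure_ne_top _ _)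
  exact (ENNReal.rpow_lt_top_iff_of_pos (by linarith)).1 h2

end ComplexIntegral

/-! ### Integrated forms of isometric families on `L^p`. -/

section IntegratedForm

variable {G : Type*} [MeasurableSpace G] {X : Type*} [NormedAddCommGroup X] [NormedSpace ℂ X]
  {Y : Type*} [MeasurableSpace Y]

/-- A jointly measurable family `π` of linear operators on `X`-valued functions on `Y`, over the
transformations `η g` of `Y`, which preserves the `L^p`-norm. -/
structure IsMeasurableIsometric (π : G → (Y → X) → Y → X) (η : G → Y → Y) (p : ℝ≥0∞)
    (ν : Measure Y) : Prop where
  stronglyMeasurable : ∀ ξ : Y → X, StronglyMeasurable ξ →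
    StronglyMeasurable fun z : Y × G => π z.2 ξ z.1
  add : ∀ g ξ ζ, π g (ξ + ζ) = π g ξ + π g ζ
  smul : ∀ g (c : ℂ) ξ, π g (c • ξ) = c • π g ξ
  congr : ∀ g ξ ζ y, ξ (η g y) = ζ (η g y) → π g ξ y = π g ζ y
  measurable_flow : Measurable fun z : Y × G => η z.2 z.1
  null : ∀ g N, MeasurableSet N → ν N = 0 → ν {y | η g y ∈ N} = 0
  lintegral_eq : ∀ g ξ, StronglyMeasurable ξ →
    ∫⁻ y, ‖π g ξ y‖ₑ ^ p.toReal ∂ν = ∫⁻ y, ‖ξ y‖ₑ ^ p.toReal ∂ν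

theorem one_le_toReal {p : ℝ≥0∞} [hp1 : Fact (1 ≤ p)] (hp : p ≠ ∞) : 1 ≤ p.toReal := by
  rw [← ENNReal.toReal_one]
  exact (ENNReal.toReal_le_toReal ENNReal.one_ne_top hp).2 hp1.out

theorem lintegral_rpow_lt_top_of_memLp {E : Type*} [NormedAddCommGroup E] {ν : Measure Y}
    {p : ℝ≥0∞} [hp1 : Fact (1 ≤ p)] (hp : p ≠ ∞) {f : Y → E} (hf : MemLp f p ν) :
    ∫⁻ y, ‖f y‖ₑ ^ p.toReal ∂ν < ∞ :=
  lintegral_rpow_enorm_lt_top_of_eLpNorm_lt_top (zero_lt_one.trans_le hp1.out).ne' hp hf.2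

theorem eLpNorm_rpow_toReal {E : Type*} [NormedAddCommGroup E] {ν : Measure Y}
    {p : ℝ≥0∞} [hp1 : Fact (1 ≤ p)] (hp : p ≠ ∞) (f : Y → E) :
    eLpNorm f p ν ^ p.toReal = ∫⁻ y, ‖f y‖ₑ ^ p.toReal ∂ν := by
  have h := one_le_toReal hp
  rw [eLpNorm_eq_lintegral_rpow_enorm_toReal (zero_lt_one.trans_le hp1.out).ne' hp,
    ← ENNReal.rpow_mul, one_div, inv_mul_cancel₀ (by linarith), ENNReal.rpow_one]

namespace IsMeasurableIsometric

variable {π : G → (Y → X) → Y → X} {η : G → Y → Y} {p : ℝ≥0∞}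
  {ν : Measure Y} [SFinite ν]

theorem lintegral_lintegral (h : IsMeasurableIsometric π η p ν) (m : Measure G) [SFinite m]
    {ξ : Y → X} (hξ : StronglyMeasurable ξ) :
    ∫⁻ y, ∫⁻ g, ‖π g ξ y‖ₑ ^ p.toReal ∂m ∂ν = m Set.univ * ∫⁻ y, ‖ξ y‖ₑ ^ p.toReal ∂ν := by
  rw [lintegral_lintegral_swap]
  · simp_rw [h.lintegral_eq _ ξ hξ]
    rw [lintegral_const, mul_comm]
  · exact ((h.stronglyMeasurable ξ hξ).enorm.pow_const _).aemeasurable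

/-- For each fixed `g` the bad set of `y` is null; Tonelli exchanges the order of the quantifiers.
-/
theorem ae_ae_flow_notMem (hflow : Measurable fun z : Y × G => η z.2 z.1)
    (hnull : ∀ g N, MeasurableSet N → ν N = 0 → ν {y | η g y ∈ N} = 0)
    (m : Measure G) [SFinite m] {N : Set Y} (hN : MeasurableSet N) (h0 : ν N = 0) :
    ∀ᵐ y ∂ν, ∀ᵐ g ∂m, η g y ∉ N := by
  have hmeas : MeasurableSet {z : Y × G | η z.2 z.1 ∈ N} := hflow hN
  have h2 : ∀ᵐ z ∂(ν.prod m), η z.2 z.1 ∉ N := by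
    rw [ae_iff]
    simp only [not_not]
    rw [Measure.prod_apply_symm hmeas]
    simp only [Set.preimage_ofPred_eq]
    simp [hnull _ N hN h0]
  exact Measure.ae_ae_of_ae_prod h2

/-- Makes the integrated form independent of the representative of an `L^p` class: `π g ξ y` sees
`ξ` only at `η g y`, which for almost all pairs avoids the null set of disagreement. -/
theorem ae_ae_congr (h : IsMeasurableIsometric π η p ν) (m : Measure G) [SFinite m]
    {ξ ζ : Y → X} (hξζ : ξ =ᵐ[ν] ζ) :
    ∀ᵐ y ∂ν, ∀ᵐ g ∂m, π g ξ y = π g ζ y := by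
  have h0 : ν (toMeasurable ν {y | ¬ ξ y = ζ y}) = 0 := by
    rw [measure_toMeasurable]; exact hξζ
  filter_upwards [ae_ae_flow_notMem h.measurable_flow h.null m (measurableSet_toMeasurable _ _) h0]
    with y hy
  filter_upwards [hy] with g hg
  refine h.congr g ξ ζ y ?_
  by_contra hne
  exact hg (subset_toMeasurable _ _ hne)

variable [hp1 : Fact (1 ≤ p)]

theorem ae_integrable (h : IsMeasurableIsometric π η p ν) (hp : p ≠ ∞) (m : Measure G)
    [IsFiniteMeasure m] {ξ : Y → X} (hξ : StronglyMeasurable ξ) (hξp : MemLp ξ p ν) :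
    ∀ᵐ y ∂ν, Integrable (fun g => π g ξ y) m := by
  have hm := ((h.stronglyMeasurable ξ hξ).enorm.pow_const p.toReal)
  have h1 : ∫⁻ y, ∫⁻ g, ‖π g ξ y‖ₑ ^ p.toReal ∂m ∂ν ≠ ∞ := by
    rw [h.lintegral_lintegral m hξ]
    exact ENNReal.mul_ne_top (measure_ne_top _ _) (lintegral_rpow_lt_top_of_memLp hp hξp).ne
  have h2 := ae_lt_top (Measurable.lintegral_prod_right' (ν := m) hm) h1
  filter_upwards [h2] with y hy
  refine integrable_of_lintegral_rpow_ne_top m ?_ (one_le_toReal hp) hy.ne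
  exact ((h.stronglyMeasurable ξ hξ).comp_measurable
    (measurable_prodMk_left (x := y))).aestronglyMeasurable

/-- Hölder in `g` costs the total mass to the power `p - 1`; Tonelli and the isometry property
contribute one further factor of it. -/
theorem lintegral_cintegral_le (h : IsMeasurableIsometric π η p ν) (hp : p ≠ ∞)
    (μ : ComplexMeasure G) {ξ : Y → X} (hξ : StronglyMeasurable ξ) :
    ∫⁻ y, ‖cintegral μ (fun g => π g ξ y)‖ₑ ^ p.toReal ∂ν ≤
      μ.variation Set.univ ^ p.toReal * ∫⁻ y, ‖ξ y‖ₑ ^ p.toReal ∂ν := by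
  have hq := one_le_toReal hp
  calc _ ≤ ∫⁻ y, μ.variation Set.univ ^ (p.toReal - 1) *
        ∫⁻ g, ‖π g ξ y‖ₑ ^ p.toReal ∂μ.variation ∂ν := by
        refine lintegral_mono fun y => enorm_cintegral_rpow_le μ ?_ hq
        exact ((h.stronglyMeasurable ξ hξ).comp_measurable
          (measurable_prodMk_left (x := y))).aestronglyMeasurable
    _ = μ.variation Set.univ ^ (p.toReal - 1) * (μ.variation Set.univ *
        ∫⁻ y, ‖ξ y‖ₑ ^ p.toReal ∂ν) := by
        rw [lintegral_const_mul', h.lintegral_lintegral _ hξ]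
        exact (ENNReal.rpow_lt_top_of_nonneg (by linarith) (measure_ne_top _ _)).ne
    _ = _ := by
        rw [← mul_assoc]
        congr 1
        nth_rewrite 2 [← ENNReal.rpow_one (μ.variation Set.univ)]
        rw [← ENNReal.rpow_add_of_nonneg _ _ (by linarith) zero_le_one, sub_add_cancel]

theorem eLpNorm_cintegral_le (h : IsMeasurableIsometric π η p ν) (hp : p ≠ ∞)
    (μ : ComplexMeasure G) {ξ : Y → X} (hξ : StronglyMeasurable ξ) :
    eLpNorm (fun y => cintegral μ (fun g => π g ξ y)) p ν ≤
      μ.variation Set.univ * eLpNorm ξ p ν := by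
  have hq := one_le_toReal hp
  have hq0 : 0 < p.toReal := by linarith
  rw [← ENNReal.rpow_le_rpow_iff hq0, ENNReal.mul_rpow_of_nonneg _ _ hq0.le,
    eLpNorm_rpow_toReal hp, eLpNorm_rpow_toReal hp]
  exact h.lintegral_cintegral_le hp μ hξ

theorem memLp_cintegral (h : IsMeasurableIsometric π η p ν) (hp : p ≠ ∞)
    (μ : ComplexMeasure G) {ξ : Y → X} (hξ : StronglyMeasurable ξ) (hξp : MemLp ξ p ν) :
    MemLp (fun y => cintegral μ (fun g => π g ξ y)) p ν := by
  refine ⟨(stronglyMeasurable_cintegral μ ?_).aestronglyMeasurable,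
    (h.eLpNorm_cintegral_le hp μ hξ).trans_lt (ENNReal.mul_lt_top (measure_lt_top _ _) hξp.2)⟩
  exact h.stronglyMeasurable ξ hξ

theorem cintegral_congr_ae (h : IsMeasurableIsometric π η p ν) (μ : ComplexMeasure G)
    {ξ ζ : Y → X} (hξζ : ξ =ᵐ[ν] ζ) :
    ∀ᵐ y ∂ν, cintegral μ (fun g => π g ξ y) = cintegral μ (fun g => π g ζ y) := by
  filter_upwards [h.ae_ae_congr μ.variation hξζ] with y hy
  exact VectorMeasure.integral_congr_ae hy

/-- The operator `∫ π(g) dμ(g)` on `L^p`. -/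
def integratedForm (h : IsMeasurableIsometric π η p ν) (hp : p ≠ ∞) (μ : ComplexMeasure G) :
    Lp X p ν →L[ℂ] Lp X p ν :=
  LinearMap.mkContinuous
    { toFun := fun ξ => (h.memLp_cintegral hp μ (Lp.stronglyMeasurable ξ) (Lp.memLp ξ)).toLp _
      map_add' := fun ξ ζ => by
        rw [← MemLp.toLp_add]
        refine (MemLp.toLp_eq_toLp_iff _ _).2 ?_
        filter_upwards [h.cintegral_congr_ae μ (Lp.coeFn_add ξ ζ),
          h.ae_integrable hp μ.variation (Lp.stronglyMeasurable ξ) (Lp.memLp ξ),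
          h.ae_integrable hp μ.variation (Lp.stronglyMeasurable ζ) (Lp.memLp ζ)] with y h1 h2 h3
        rw [h1]
        simp only [h.add, Pi.add_apply]
        exact cintegral_add h2 h3
      map_smul' := fun c ξ => by
        rw [RingHom.id_apply, ← MemLp.toLp_const_smul]
        refine (MemLp.toLp_eq_toLp_iff _ _).2 ?_
        filter_upwards [h.cintegral_congr_ae μ (Lp.coeFn_smul c ξ)] with y h1
        rw [h1]
        simp only [h.smul, Pi.smul_apply]
        exact cintegral_smul c _ }
    (μ.variation Set.univ).toReal fun ξ => by
      simp only [LinearMap.coe_mk, AddHom.coe_mk, Lp.norm_toLp]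
      rw [Lp.norm_def, ← ENNReal.toReal_mul]
      exact ENNReal.toReal_mono (ENNReal.mul_ne_top (measure_ne_top _ _) (Lp.eLpNorm_ne_top ξ))
        (h.eLpNorm_cintegral_le hp μ (Lp.stronglyMeasurable ξ))

theorem integratedForm_coeFn (h : IsMeasurableIsometric π η p ν) (hp : p ≠ ∞)
    (μ : ComplexMeasure G) (ξ : Lp X p ν) :
    h.integratedForm hp μ ξ =ᵐ[ν] fun y => cintegral μ (fun g => π g ξ y) :=
  MemLp.coeFn_toLp (h.memLp_cintegral hp μ (Lp.stronglyMeasurable ξ) (Lp.memLp ξ))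

theorem isIntegratedForm (h : IsMeasurableIsometric π η p ν) (hp : p ≠ ∞)
    (μ : ComplexMeasure G) : IsIntegratedForm π μ p ν (h.integratedForm hp μ) := by
  intro ξ hξ
  filter_upwards [h.integratedForm_coeFn hp μ (hξ.toLp ξ),
    h.ae_ae_congr μ.variation hξ.coeFn_toLp,
    h.ae_integrable hp μ.variation (Lp.stronglyMeasurable (hξ.toLp ξ))
      (Lp.memLp (hξ.toLp ξ))] with y h1 h2 h3
  refine ⟨h3.congr h2, ?_⟩
  rw [h1]
  exact VectorMeasure.integral_congr_ae h2

end IsMeasurableIsometric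

end IntegratedForm

/-! ### Measurability of the modular function. -/

section Modular

variable {K : Type*} [Group K] [TopologicalSpace K] [IsTopologicalGroup K] [LocallyCompactSpace K]

theorem modularFn_mul (g h : K) : modularFn (g * h) = modularFn g * modularFn h := by
  simp [modularFn, mul_comm]

theorem modularFn_ne_zero (g : K) : modularFn g ≠ 0 :=
  inv_ne_zero (Measure.modularCharacterFun_pos g).ne'

theorem exists_measurableSet_measure_pos_lt_top {α : Type*} [TopologicalSpace α]
    [MeasurableSpace α] [OpensMeasurableSpace α] [Nonempty α] (m : Measure α)
    [IsLocallyFiniteMeasure m] [m.IsOpenPosMeasure] :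
    ∃ E : Set α, MeasurableSet E ∧ m E ≠ 0 ∧ m E ≠ ∞ := by
  obtain ⟨U, hxU, hU, hlt⟩ := m.exists_isOpen_measure_lt_top (Classical.arbitrary α)
  exact ⟨U, hU.measurableSet, (hU.measure_pos m ⟨_, hxU⟩).ne', hlt.ne⟩

/-- The inverse of the modular function is a quotient of Haar measures of a set and its right
translate, written as a parameter integral that Tonelli shows to be measurable. -/
theorem measurable_modularFn [SecondCountableTopology K] [T2Space K] [MeasurableSpace K]
    [BorelSpace K] : Measurable (modularFn : K → ℝ≥0) := by
  obtain ⟨E, hE, h0, ht⟩ := exists_measurableSet_measure_pos_lt_top (Measure.haar (G := K))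
  have h1 : ∀ h : K, ((modularFn h)⁻¹ : ℝ≥0) =
      ((∫⁻ g, E.indicator 1 (g * h) ∂(Measure.haar (G := K))) / Measure.haar E).toNNReal :=
      fun h => by
    rw [lintegral_mul_right Measure.haar h _ (measurable_one.indicator hE),
      lintegral_indicator_one hE, ENNReal.mul_div_cancel_right h0 ht, ENNReal.toNNReal_coe]
  have h2 : Measurable fun h : K => ((modularFn h)⁻¹ : ℝ≥0) := by
    simp_rw [h1]
    refine (Measurable.div_const ?_ _).ennreal_toNNReal
    refine Measurable.lintegral_prod_right (f := fun h g : K => E.indicator 1 (g * h)) ?_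
    exact (measurable_one.indicator hE).comp (measurable_snd.mul measurable_fst)
  have h3 : (fun h : K => (modularFn h)⁻¹)⁻¹ = modularFn := funext fun h => inv_inv _
  exact h3 ▸ h2.inv

end Modular

/-! ### Disintegration over `G ⧸ S` and isometry of the induced representation. -/

section Quotient

variable {G : Type*} [Group G] [TopologicalSpace G] [IsTopologicalGroup G]
  [LocallyCompactSpace G] [T2Space G] [SecondCountableTopology G]
  [MeasurableSpace G] [BorelSpace G] {S : Subgroup G} [IsClosed (S : Set G)]

instance secondCountableTopology_subgroup (H : Subgroup G) : SecondCountableTopology H :=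
  TopologicalSpace.Subtype.secondCountableTopology (H : Set G)

theorem modularRatio_mul (s t : S) :
    modularRatio S (s * t) = modularRatio S s * modularRatio S t := by
  simp only [modularRatio, Subgroup.coe_mul, modularFn_mul]
  rw [mul_div_mul_comm]

theorem modularRatio_ne_zero (s : S) : modularRatio S s ≠ 0 :=
  div_ne_zero (modularFn_ne_zero _) (modularFn_ne_zero _)

theorem measurable_modularRatio : Measurable (modularRatio S : S → ℝ≥0) :=
  (measurable_modularFn.comp measurable_subtype_coe).div measurable_modularFn

namespace CrossSection

variable (σ : CrossSection S)

theorem mk_mul (g : G) (s : S) : ((g * (s : G) : G) : G ⧸ S) = (g : G ⧸ S) :=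
  QuotientGroup.mk_mul_of_mem g s.2

theorem tau_mul (g : G) (s : S) : σ.tau (g * s) = σ.tau g * s := by
  ext
  simp only [tau, Subgroup.coe_mul, mk_mul, mul_assoc]

theorem tau_toFun (x : G ⧸ S) : σ.tau (σ.toFun x) = 1 := by
  ext
  simp [tau, σ.mk_toFun]

theorem tau_toFun_mul (x : G ⧸ S) (s : S) : σ.tau (σ.toFun x * s) = s := by
  rw [tau_mul, tau_toFun, one_mul]

theorem measurable_mk : Measurable (fun g : G => (g : G ⧸ S)) := measurable_quotient_mk''

theorem measurable_tau : Measurable σ.tau :=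
  Measurable.subtype_mk ((σ.measurable_toFun.comp measurable_mk).inv.mul measurable_id)

theorem measurable_inv_mul_toFun : Measurable fun z : (G ⧸ S) × G => z.2⁻¹ * σ.toFun z.1 :=
  measurable_snd.inv.mul (σ.measurable_toFun.comp measurable_fst)

theorem measurable_tau₂ : Measurable fun z : (G ⧸ S) × G => σ.tau₂ z.2 z.1 :=
  σ.measurable_tau.comp σ.measurable_inv_mul_toFun

theorem measurable_eta₂ : Measurable fun z : (G ⧸ S) × G => σ.eta₂ z.2 z.1 :=
  measurable_mk.comp σ.measurable_inv_mul_toFun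

end CrossSection

theorem measurable_modularRatio_coe : Measurable fun s : S => (modularRatio S s : ℝ≥0∞) :=
  measurable_modularRatio.coe_nnreal_ennreal

namespace IsQuotientMeasure

variable {σ : CrossSection S} {mG : Measure G} {mS : Measure S} {ν : Measure (G ⧸ S)}

theorem sigmaFinite (hν : IsQuotientMeasure σ mG mS ν) : SigmaFinite ν := by
  have : SigmaCompactSpace (G ⧸ S) := by
    refine isSigmaCompact_univ_iff.1 ?_
    have h := (isSigmaCompact_univ (X := G)).image (f := fun g : G => (g : G ⧸ S))
      QuotientGroup.continuous_mk
    rwa [Set.image_univ, QuotientGroup.mk_surjective.range_eq] at h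
  exact ⟨⟨⟨compactCovering (G ⧸ S), fun _ => trivial,
    fun n => hν.finite_of_isCompact _ (isCompact_compactCovering _ n),
    iUnion_compactCovering _⟩⟩⟩

/-- Quasi-invariance of `ν` with its Radon–Nikodym factor. It follows from left invariance of `mG`
tested on `h ↦ F(hS) b(τ(h))`. Since `b` times `Δ` is the indicator of `E`, each fibre integral
equals `mS E` by left invariance of `mS`, and this positive finite factor cancels. -/
theorem lintegral_flow (hν : IsQuotientMeasure σ mG mS ν) [mG.IsHaarMeasure] [mS.IsHaarMeasure]
    (g : G) {F : G ⧸ S → ℝ≥0∞} (hF : Measurable F) :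
    ∫⁻ y, (modularRatio S (σ.tau₂ g y) : ℝ≥0∞)⁻¹ * F (σ.eta₂ g y) ∂ν = ∫⁻ y, F y ∂ν := by
  obtain ⟨E, hE, h0, ht⟩ := exists_measurableSet_measure_pos_lt_top mS
  set b : S → ℝ≥0∞ := fun s => (modularRatio S s : ℝ≥0∞)⁻¹ * E.indicator 1 s with hb
  have hbm : Measurable b := measurable_modularRatio_coe.inv.mul (measurable_one.indicator hE)
  have hΔ0 : ∀ s : S, (modularRatio S s : ℝ≥0∞) ≠ 0 := fun s => by
    simpa using modularRatio_ne_zero s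
  have hcanc : ∀ s : S, b s * (modularRatio S s : ℝ≥0∞) = E.indicator 1 s := fun s => by
    rw [hb]
    simp only
    rw [mul_right_comm, ENNReal.inv_mul_cancel (hΔ0 s) ENNReal.coe_ne_top, one_mul]
  have hbint : ∫⁻ s, b s * (modularRatio S s : ℝ≥0∞) ∂mS = mS E := by
    simp_rw [hcanc]
    exact lintegral_indicator_one hE
  set f : G → ℝ≥0∞ := fun h => F (h : G ⧸ S) * b (σ.tau h) with hf
  have hfm : Measurable f :=
    (hF.comp CrossSection.measurable_mk).mul (hbm.comp σ.measurable_tau)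
  have h1 : ∫⁻ h, f h ∂mG = (∫⁻ y, F y ∂ν) * mS E := by
    rw [hν.lintegral_eq f hfm, ← lintegral_mul_const _ hF]
    refine lintegral_congr fun x => ?_
    rw [← hbint, ← lintegral_const_mul (F x)
      (f := fun s => b s * (modularRatio S s : ℝ≥0∞)) (hbm.mul measurable_modularRatio_coe)]
    refine lintegral_congr fun s => ?_
    simp only [hf, CrossSection.mk_mul, σ.mk_toFun, σ.tau_toFun_mul, mul_assoc]
  have hFm : Measurable fun y =>
      (modularRatio S (σ.tau₂ g y) : ℝ≥0∞)⁻¹ * F (σ.eta₂ g y) :=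
    (measurable_modularRatio_coe.comp
      (σ.measurable_tau₂.comp (measurable_prodMk_right (y := g)))).inv.mul
      (hF.comp (σ.measurable_eta₂.comp (measurable_prodMk_right (y := g))))
  have h2 : ∫⁻ h, f (g⁻¹ * h) ∂mG =
      (∫⁻ y, (modularRatio S (σ.tau₂ g y) : ℝ≥0∞)⁻¹ * F (σ.eta₂ g y) ∂ν) * mS E := by
    rw [hν.lintegral_eq (fun h => f (g⁻¹ * h)) (hfm.comp (measurable_const_mul g⁻¹)),
      ← lintegral_mul_const _ hFm]
    refine lintegral_congr fun x => ?_
    have hshift : ∫⁻ s, b (σ.tau₂ g x * s) * (modularRatio S (σ.tau₂ g x * s) : ℝ≥0∞) ∂mS =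
        mS E := by
      rw [← hbint]
      exact lintegral_mul_left_eq_self (fun s => b s * (modularRatio S s : ℝ≥0∞)) _
    rw [← hshift, ← lintegral_const_mul]
    · refine lintegral_congr fun s => ?_
      simp only [hf, ← mul_assoc g⁻¹, CrossSection.mk_mul, σ.tau_mul]
      change F (σ.eta₂ g x) * b (σ.tau₂ g x * s) * _ = _
      rw [modularRatio_mul, ENNReal.coe_mul]
      calc _ = ((modularRatio S (σ.tau₂ g x) : ℝ≥0∞)⁻¹ * (modularRatio S (σ.tau₂ g x) : ℝ≥0∞)) *
            (F (σ.eta₂ g x) * b (σ.tau₂ g x * s) * (modularRatio S s : ℝ≥0∞)) := by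
            rw [ENNReal.inv_mul_cancel (hΔ0 _) ENNReal.coe_ne_top, one_mul]
        _ = _ := by ring
    · exact (hbm.comp (measurable_const_mul _)).mul
        (measurable_modularRatio_coe.comp (measurable_const_mul _))
  have h3 : ∫⁻ h, f (g⁻¹ * h) ∂mG = ∫⁻ h, f h ∂mG := lintegral_mul_left_eq_self f g⁻¹
  rw [h1, h2] at h3
  exact (ENNReal.mul_left_inj h0 ht).1 h3

/-- Because `Δ` never vanishes, a null set of `G` meets almost every fibre in a null set. -/
theorem ae_of_ae (hν : IsQuotientMeasure σ mG mS ν) [SFinite mS] {P : G → Prop}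
    (hP : ∀ᵐ g ∂mG, P g) : ∀ᵐ x ∂ν, ∀ᵐ s ∂mS, P (σ.toFun x * (s : S)) := by
  obtain ⟨N, hsub, hN, h0⟩ := exists_measurable_superset_of_null (ae_iff.1 hP)
  have h1 := hν.lintegral_eq (N.indicator 1) (measurable_one.indicator hN)
  rw [lintegral_indicator_one hN, h0] at h1
  have hm : Measurable fun z : (G ⧸ S) × S =>
      N.indicator (1 : G → ℝ≥0∞) (σ.toFun z.1 * (z.2 : G)) * (modularRatio S z.2 : ℝ≥0∞) :=
    ((measurable_one.indicator hN).comp ((σ.measurable_toFun.comp measurable_fst).mul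
      (measurable_subtype_coe.comp measurable_snd))).mul
      (measurable_modularRatio_coe.comp measurable_snd)
  have h2 := (lintegral_eq_zero_iff (Measurable.lintegral_prod_right' (ν := mS) hm)).1 h1.symm
  filter_upwards [h2] with x hx
  have h3 := (lintegral_eq_zero_iff (hm.comp (measurable_prodMk_left (x := x)))).1 hx
  filter_upwards [h3] with s hs
  by_contra hPs
  have hmem : σ.toFun x * (s : G) ∈ N := hsub hPs
  simp only [Function.comp, Set.indicator_of_mem hmem, Pi.one_apply, one_mul, Pi.zero_apply] at hs
  exact modularRatio_ne_zero s (by simpa using hs)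

end IsQuotientMeasure

section Representation

variable {X : Type*} [NormedAddCommGroup X] [NormedSpace ℂ X]

theorem isMeasurableIsometric_leftRegular (mG : Measure G) [mG.IsHaarMeasure] (p : ℝ≥0∞) :
    IsMeasurableIsometric (leftRegular : G → (G → X) → G → X) (fun g y => g⁻¹ * y) p mG where
  stronglyMeasurable ξ hξ := hξ.comp_measurable (measurable_snd.inv.mul measurable_fst)
  add _ _ _ := rfl
  smul _ _ _ := rfl
  congr _ _ _ _ h := h
  measurable_flow := measurable_snd.inv.mul measurable_fst
  null g N _ h0 := by
    have := measure_preimage_mul mG g⁻¹ N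
    rw [h0] at this
    exact this
  lintegral_eq g ξ _ := lintegral_mul_left_eq_self (fun y => ‖ξ y‖ₑ ^ p.toReal) g⁻¹

/-- Isometries are equicontinuous, so strong continuity upgrades to joint continuity. -/
theorem continuous_isometric_action {T : Type*} [TopologicalSpace T] {r : T → X ≃ₗᵢ[ℂ] X}
    (hr : ∀ x, Continuous fun t => r t x) : Continuous fun z : T × X => r z.1 z.2 := by
  rw [continuous_iff_continuousAt]
  rintro ⟨t, x⟩
  rw [ContinuousAt, tendsto_iff_norm_sub_tendsto_zero]
  have h1 : Filter.Tendsto (fun z : T × X => ‖z.2 - x‖ + ‖r z.1 x - r t x‖) (nhds (t, x))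
      (nhds (‖x - x‖ + ‖r t x - r t x‖)) := by
    refine Continuous.tendsto (f := fun z : T × X => ‖z.2 - x‖ + ‖r z.1 x - r t x‖) ?_ (t, x)
    exact ((continuous_snd.sub continuous_const).norm).add
      ((((hr x).comp continuous_fst).sub continuous_const).norm)
  rw [sub_self, sub_self, norm_zero, add_zero] at h1
  refine squeeze_zero (fun _ => norm_nonneg _) (fun z => ?_) h1
  calc ‖r z.1 z.2 - r t x‖ = ‖r z.1 (z.2 - x) + (r z.1 x - r t x)‖ := by
        rw [map_sub]; congr 1; abel
    _ ≤ _ := by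
        refine (norm_add_le _ _).trans ?_
        rw [LinearIsometryEquiv.norm_map]

theorem stronglyMeasurable_isometric_action {α : Type*} [MeasurableSpace α]
    {ρ : S →* (X ≃ₗᵢ[ℂ] X)} (hρ : ∀ x : X, Continuous fun s : S => ρ s x) {t : α → S}
    (ht : Measurable t) {v : α → X} (hv : StronglyMeasurable v) :
    StronglyMeasurable fun a => ρ (t a) (v a) := by
  have : TopologicalSpace.MetrizableSpace S :=
    TopologicalSpace.metrizableSpace_of_t3_secondCountable S
  exact (continuous_isometric_action (r := fun s => ρ s) hρ).comp_stronglyMeasurable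
    (ht.stronglyMeasurable.prodMk hv)

theorem measurable_modularRatio_rpow (c : ℝ) :
    Measurable fun s : S => (((modularRatio S s : ℝ) ^ c : ℝ) : ℂ) :=
  Complex.measurable_ofReal.comp (measurable_modularRatio.coe_nnreal_real.pow_const c)

/-- The exponent `-1/p` is chosen so that the `p`-th power of the norm carries exactly the factor
`Δ⁻¹` of `lintegral_flow`. -/
theorem enorm_modularRatio_rpow_smul {p : ℝ≥0∞} [Fact (1 ≤ p)] (hp : p ≠ ∞) (s : S) (x : X) :
    ‖(((modularRatio S s : ℝ) ^ (-(1 / p.toReal)) : ℝ) : ℂ) • x‖ₑ ^ p.toReal =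
      (modularRatio S s : ℝ≥0∞)⁻¹ * ‖x‖ₑ ^ p.toReal := by
  have hq := one_le_toReal hp
  have hpos : (0 : ℝ) < modularRatio S s :=
    NNReal.coe_pos.2 (pos_iff_ne_zero.2 (modularRatio_ne_zero s))
  rw [enorm_smul, ENNReal.mul_rpow_of_nonneg _ _ (by linarith)]
  congr 1
  rw [← ofReal_norm, Complex.norm_real, Real.norm_of_nonneg (Real.rpow_nonneg hpos.le _),
    ENNReal.ofReal_rpow_of_nonneg (Real.rpow_nonneg hpos.le _) (by linarith),
    ← Real.rpow_mul hpos.le, neg_mul, one_div, inv_mul_cancel₀ (by linarith), Real.rpow_neg_one,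
    ENNReal.ofReal_inv_of_pos hpos, ENNReal.ofReal_coe_nnreal]

theorem isMeasurableIsometric_inducedRep {σ : CrossSection S} {mG : Measure G} {mS : Measure S}
    {ν : Measure (G ⧸ S)} (hν : IsQuotientMeasure σ mG mS ν) [mG.IsHaarMeasure]
    [mS.IsHaarMeasure] {p : ℝ≥0∞} [Fact (1 ≤ p)] (hp : p ≠ ∞)
    {ρ : S →* (X ≃ₗᵢ[ℂ] X)} (hρ : ∀ x : X, Continuous fun s : S => ρ s x) :
    IsMeasurableIsometric (inducedRep σ ρ p) σ.eta₂ p ν where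
  stronglyMeasurable ξ hξ := by
    refine StronglyMeasurable.smul
      ((measurable_modularRatio_rpow _).comp σ.measurable_tau₂).stronglyMeasurable ?_
    exact stronglyMeasurable_isometric_action hρ σ.measurable_tau₂.inv
      (hξ.comp_measurable σ.measurable_eta₂)
  add g ξ ζ := by
    ext y
    simp [inducedRep]
  smul g c ξ := by
    ext y
    simp only [inducedRep, Pi.smul_apply, map_smul]
    rw [smul_comm]
  congr g ξ ζ y h := by
    simp only [inducedRep, h]
  measurable_flow := σ.measurable_eta₂
  null g N hN h0 := by
    have h1 := hν.lintegral_flow g (F := N.indicator 1) (measurable_one.indicator hN)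
    rw [lintegral_indicator_one hN, h0] at h1
    have hm : Measurable fun y =>
        (modularRatio S (σ.tau₂ g y) : ℝ≥0∞)⁻¹ * N.indicator (1 : G ⧸ S → ℝ≥0∞) (σ.eta₂ g y) :=
      (measurable_modularRatio_coe.comp
        (σ.measurable_tau₂.comp (measurable_prodMk_right (y := g)))).inv.mul
        ((measurable_one.indicator hN).comp
          (σ.measurable_eta₂.comp (measurable_prodMk_right (y := g))))
    rw [lintegral_eq_zero_iff hm] at h1
    refine measure_mono_null ?_ (ae_iff.1 h1)
    intro y hy hcon
    rw [Set.mem_ofPred_eq] at hy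
    simp [Set.indicator_of_mem hy] at hcon
  lintegral_eq g ξ hξ := by
    rw [← hν.lintegral_flow g (hξ.enorm.pow_const p.toReal)]
    refine lintegral_congr fun y => ?_
    rw [inducedRep, enorm_modularRatio_rpow_smul hp]
    congr 2
    rw [← ofReal_norm, LinearIsometryEquiv.norm_map, ofReal_norm]

end Representation

end Quotient

open scoped CompactlySupported Topology

/-! ### Invariant means and small convex combinations of averages. -/

section Amenable

variable {K : Type*} [Group K] [TopologicalSpace K] [IsTopologicalGroup K] [LocallyCompactSpace K]
  [T2Space K] [SecondCountableTopology K] [MeasurableSpace K] [BorelSpace K]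
  (mK : Measure K) [mK.IsHaarMeasure]

section Average

variable {B : Type*} [NormedAddCommGroup B] [NormedSpace ℝ B]

/-- The average `∫ k(t) q(t⁻¹ u) dt` of the translates of `q`. -/
def average (q : K → B) (k : C_c(K, ℝ)) (u : K) : B := ∫ t, k t • q (t⁻¹ * u) ∂mK

theorem integrable_smul_translate {q : K → B} (hq : Continuous q) (k : C_c(K, ℝ)) (u : K) :
    Integrable (fun t => k t • q (t⁻¹ * u)) mK := by
  refine Continuous.integrable_of_hasCompactSupport ?_ k.hasCompactSupport.smul_right
  exact k.continuous.smul (hq.comp (continuous_inv.mul continuous_const))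

theorem norm_average_le {q : K → B} {C : ℝ} (hC : ∀ u, ‖q u‖ ≤ C)
    (k : C_c(K, ℝ)) (u : K) : ‖average mK q k u‖ ≤ (∫ t, |k t| ∂mK) * C := by
  rw [average, ← integral_mul_const]
  refine norm_integral_le_of_norm_le ?_ (Filter.Eventually.of_forall fun t => ?_)
  · exact (k.integrable.abs).mul_const C
  · rw [norm_smul, Real.norm_eq_abs]
    exact mul_le_mul_of_nonneg_left (hC _) (abs_nonneg _)

theorem continuous_average {q : K → B} (hq : Continuous q) {C : ℝ} (hC : ∀ u, ‖q u‖ ≤ C)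
    (k : C_c(K, ℝ)) : Continuous (average mK q k) := by
  refine continuous_of_dominated (bound := fun t => |k t| * C)
    (fun u => (integrable_smul_translate mK hq k u).aestronglyMeasurable)
    (fun u => Filter.Eventually.of_forall fun t => ?_) ((k.integrable.abs).mul_const C)
    (Filter.Eventually.of_forall fun t => ?_)
  · rw [norm_smul, Real.norm_eq_abs]
    exact mul_le_mul_of_nonneg_left (hC _) (abs_nonneg _)
  · exact continuous_const.smul (hq.comp (continuous_const.mul continuous_id))

theorem average_sub {q : K → B} (hq : Continuous q) (k l : C_c(K, ℝ)) (u : K) :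
    average mK q (k - l) u = average mK q k u - average mK q l u := by
  rw [average, average, average, ← integral_sub (integrable_smul_translate mK hq k u)
    (integrable_smul_translate mK hq l u)]
  simp [sub_smul]

/-- `average` as a bounded continuous function. -/
def averageBCF (H : K →ᵇ ℝ) (k : C_c(K, ℝ)) : K →ᵇ ℝ :=
  BoundedContinuousFunction.ofNormedAddCommGroup (average mK H k)
    (continuous_average mK H.continuous H.norm_coe_le_norm k) _
    (norm_average_le mK H.norm_coe_le_norm k)

theorem averageBCF_apply (H : K →ᵇ ℝ) (k : C_c(K, ℝ)) (u : K) :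
    averageBCF mK H k u = ∫ t, k t * H (t⁻¹ * u) ∂mK := rfl

theorem averageBCF_add (H : K →ᵇ ℝ) (k l : C_c(K, ℝ)) :
    averageBCF mK H (k + l) = averageBCF mK H k + averageBCF mK H l := by
  ext u
  refine Eq.trans ?_ (integral_add (integrable_smul_translate mK H.continuous k u)
    (integrable_smul_translate mK H.continuous l u))
  rw [averageBCF_apply]
  simp [add_mul]

theorem averageBCF_smul (H : K →ᵇ ℝ) (c : ℝ) (k : C_c(K, ℝ)) :
    averageBCF mK H (c • k) = c • averageBCF mK H k := by
  ext u
  rw [BoundedContinuousFunction.smul_apply, averageBCF_apply, averageBCF_apply, smul_eq_mul,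
    ← integral_const_mul]
  simp [mul_assoc]

end Average

/-- Right translate of a compactly supported function by a homeomorphism. -/
def compHomeomorph (k : C_c(K, ℝ)) (e : K ≃ₜ K) : C_c(K, ℝ) where
  toFun := k ∘ e
  continuous_toFun := k.continuous.comp e.continuous
  hasCompactSupport' := k.hasCompactSupport.comp_homeomorph e

@[simp]
theorem compHomeomorph_apply (k : C_c(K, ℝ)) (e : K ≃ₜ K) (t : K) :
    compHomeomorph k e t = k (e t) := rfl

/-- Left-invariant positive functionals on `C_c(K)` are multiples of the Haar integral. -/
theorem exists_eq_mul_integral (Λ : C_c(K, ℝ) →ₚ[ℝ] ℝ)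
    (hΛ : ∀ (w : K) (k : C_c(K, ℝ)), Λ (compHomeomorph k (Homeomorph.mulLeft w)) = Λ k) :
    ∃ c : ℝ, ∀ k : C_c(K, ℝ), Λ k = c * ∫ t, k t ∂mK := by
  -- The Riesz measure inherits left invariance, since regular measures are determined by their
  -- integrals on `C_c(K)`. Uniqueness of Haar measure then gives the constant.
  set R := RealRMK.rieszMeasure Λ with hR
  have hinv : R.IsMulLeftInvariant := by
    refine ⟨fun w => ?_⟩
    have hreg : (R.map (fun x => w * x)).Regular :=
      Measure.Regular.map (Homeomorph.mulLeft w)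
    refine Measure.ext_of_integral_eq_on_compactlySupported fun f => ?_
    rw [integral_map (measurable_const_mul w).aemeasurable
      (map_continuous f).aestronglyMeasurable]
    rw [RealRMK.integral_rieszMeasure, ← hΛ w f, ← RealRMK.integral_rieszMeasure]
    rfl
  refine ⟨Measure.haarScalarFactor R mK, fun k => ?_⟩
  rw [← RealRMK.integral_rieszMeasure Λ k,
    Measure.integral_isMulLeftInvariant_eq_smul_of_hasCompactSupport R mK (map_continuous k)
      k.hasCompactSupport, integral_smul_nnreal_measure]
  rfl

/-- A left-invariant mean does not distinguish averages with weights of equal integral. -/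
theorem mean_averageBCF {m : (K →ᵇ ℝ) →ₗ[ℝ] ℝ} (hpos : ∀ f : K →ᵇ ℝ, 0 ≤ f → 0 ≤ m f)
    (hone : m 1 = 1)
    (hinv : ∀ (k : K) (f : K →ᵇ ℝ),
        m (f.compContinuous ⟨fun x => k * x, continuous_const_mul k⟩) = m f) (H : K →ᵇ ℝ) :
    ∃ c : ℝ, ∀ k : C_c(K, ℝ), m (averageBCF mK H k) = c * ∫ t, k t ∂mK := by
  -- For `H ≥ 0` the functional `k ↦ m (averageBCF mK H k)` is positive. It is left invariant
  -- because translating the weight on the left translates the average on the left, which `m` does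
  -- not see.
  have main : ∀ H : K →ᵇ ℝ, 0 ≤ H →
      ∃ c : ℝ, ∀ k : C_c(K, ℝ), m (averageBCF mK H k) = c * ∫ t, k t ∂mK := by
    intro H hH
    let Λ₀ : C_c(K, ℝ) →ₗ[ℝ] ℝ :=
      { toFun := fun k => m (averageBCF mK H k)
        map_add' := fun k l => by rw [averageBCF_add, map_add]
        map_smul' := fun c k => by rw [averageBCF_smul, map_smul]; rfl }
    let Λ : C_c(K, ℝ) →ₚ[ℝ] ℝ := PositiveLinearMap.mk₀ Λ₀ fun k hk => by
      refine hpos _ fun u => ?_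
      change 0 ≤ averageBCF mK H k u
      rw [averageBCF_apply]
      exact integral_nonneg fun t => mul_nonneg (hk t) (hH _)
    refine exists_eq_mul_integral mK Λ fun w k => ?_
    change m (averageBCF mK H _) = m (averageBCF mK H k)
    rw [← hinv w (averageBCF mK H k)]
    congr 1
    ext u
    rw [averageBCF_apply, BoundedContinuousFunction.compContinuous_apply, ContinuousMap.coe_mk,
      averageBCF_apply, ← integral_mul_left_eq_self (fun t => k t * H (t⁻¹ * (w * u))) w]
    refine integral_congr_ae (Filter.Eventually.of_forall fun t => ?_)
    simp [mul_assoc]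
  -- Adding the constant `‖H‖` makes the function nonnegative and adds `‖H‖ ∫ k` to every average,
  -- which explains the constant `c - ‖H‖` below.
  obtain ⟨c, hc⟩ := main (H + ‖H‖ • 1) fun u => by
    have := neg_le_of_abs_le (H.norm_coe_le_norm u)
    change 0 ≤ H u + ‖H‖ * 1
    linarith
  refine ⟨c - ‖H‖, fun k => ?_⟩
  have h1 : averageBCF mK (H + ‖H‖ • 1) k = averageBCF mK H k + (‖H‖ * ∫ t, k t ∂mK) • 1 := by
    ext u
    change ∫ t, k t * (H (t⁻¹ * u) + ‖H‖ * 1) ∂mK =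
      ∫ t, k t * H (t⁻¹ * u) ∂mK + (‖H‖ * ∫ t, k t ∂mK) * 1
    rw [mul_one (‖H‖ * ∫ t, k t ∂mK), ← integral_const_mul]
    refine Eq.trans ?_ (integral_add (integrable_smul_translate mK H.continuous k u)
      (k.integrable.const_mul _))
    refine integral_congr_ae (Filter.Eventually.of_forall fun t => ?_)
    change k t * (H (t⁻¹ * u) + ‖H‖ * 1) = k t * H (t⁻¹ * u) + ‖H‖ * k t
    ring
  have h2 := hc k
  rw [h1, map_add, map_smul, hone, smul_eq_mul, mul_one] at h2
  linarith

/-- In an amenable group, convex combinations of averages with finitely many weights of integral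
zero can be made arbitrarily small simultaneously. -/
theorem exists_convex_combination_average_small (hK : IsAmenable K) {B : Type*}
    [NormedAddCommGroup B] [NormedSpace ℝ B] [CompleteSpace B] {q : K → B} (hq : Continuous q)
    {C : ℝ} (hC : ∀ u, ‖q u‖ ≤ C) {J : Type*} [Fintype J] (k : J → C_c(K, ℝ))
    (hk : ∀ j, ∫ t, k j t ∂mK = 0) {ε : ℝ} (hε : 0 < ε) :
    ∃ (s : Finset K) (w : K → ℝ), (∀ u ∈ s, 0 ≤ w u) ∧ ∑ u ∈ s, w u = 1 ∧
      ∀ j, ‖∑ u ∈ s, w u • average mK q (k j) u‖ < ε := by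
  classical
  obtain ⟨m, hpos, hone, hinv⟩ := hK
  set A : K → (J → B) := fun u j => average mK q (k j) u with hA
  -- Otherwise Hahn–Banach gives a functional `f` with `f (A u) > r > 0` for all `u`, so this
  -- bounded function of `u` has mean at least `r`. But it is a sum of averages with weights of
  -- integral zero, whose mean is zero. Working in the product over `J` treats all the weights at
  -- once.
  have h0 : (0 : J → B) ∈ closure (convexHull ℝ (Set.range A)) := by
    by_contra hcon
    obtain ⟨f, r, hf0, hfr⟩ := geometric_hahn_banach_point_closed
      (convex_convexHull ℝ (Set.range A)).closure isClosed_closure hcon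
    rw [map_zero] at hf0
    let fj : J → StrongDual ℝ B := fun j => f.comp (ContinuousLinearMap.single ℝ (fun _ => B) j)
    let H : J → (K →ᵇ ℝ) := fun j => BoundedContinuousFunction.ofNormedAddCommGroup
      (fun u => fj j (q u)) ((fj j).continuous.comp hq) (‖fj j‖ * C) fun u =>
        ((fj j).le_opNorm _).trans (mul_le_mul_of_nonneg_left (hC u) (norm_nonneg _))
    have hfA : ∀ u, f (A u) = (∑ j, averageBCF mK (H j) (k j)) u := by
      intro u
      have e1 : A u = ∑ j, ContinuousLinearMap.single ℝ (fun _ => B) j (A u j) := by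
        simp [ContinuousLinearMap.single_apply, Finset.univ_sum_single]
      rw [BoundedContinuousFunction.sum_apply]
      conv_lhs => rw [e1]
      rw [map_sum]
      refine Finset.sum_congr rfl fun j _ => ?_
      change fj j (average mK q (k j) u) = _
      rw [average, ← ContinuousLinearMap.integral_comp_comm _
        (integrable_smul_translate mK hq (k j) u), averageBCF_apply]
      simp [H]
    have hm0 : m (∑ j, averageBCF mK (H j) (k j)) = 0 := by
      rw [map_sum]
      refine Finset.sum_eq_zero fun j _ => ?_
      obtain ⟨c, hc⟩ := mean_averageBCF mK hpos hone hinv (H j)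
      rw [hc, hk, mul_zero]
    have hm1 : 0 ≤ m (∑ j, averageBCF mK (H j) (k j) - r • 1) := by
      refine hpos _ fun u => ?_
      have := hfr (A u) (subset_closure (subset_convexHull ℝ _ ⟨u, rfl⟩))
      rw [hfA] at this
      change 0 ≤ (∑ j, averageBCF mK (H j) (k j)) u - r * 1
      linarith
    rw [map_sub, map_smul, hm0, hone, smul_eq_mul] at hm1
    linarith
  obtain ⟨v, hv, hvε⟩ := Metric.mem_closure_iff.1 h0 ε hε
  rw [convexHull_range_eq_exists_affineCombination] at hv
  obtain ⟨s, w, hw0, hw1, rfl⟩ := hv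
  refine ⟨s, w, hw0, hw1, fun j => ?_⟩
  rw [s.affineCombination_eq_linear_combination _ _ hw1, dist_zero_left] at hvε
  refine lt_of_le_of_lt ?_ hvε
  refine le_trans (le_of_eq ?_) (norm_le_pi_norm _ j)
  congr 1
  simp [A, Finset.sum_apply]

end Amenable

open scoped CompactlySupported Topology Pointwise

/-! ### Reiter's property from an invariant mean. -/

section Reiter

variable {K : Type*} [Group K] [TopologicalSpace K] [IsTopologicalGroup K] [LocallyCompactSpace K]
  [T2Space K] [SecondCountableTopology K] [MeasurableSpace K] [BorelSpace K]
  (mK : Measure K) [mK.IsHaarMeasure]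

theorem integral_mul_right_eq_smul {B : Type*} [NormedAddCommGroup B] [NormedSpace ℝ B]
    {f : K → B} (hf : Continuous f) (w : K) :
    ∫ t, f (t * w) ∂mK = (Measure.modularCharacterFun w : ℝ) • ∫ t, f t ∂mK := by
  have h := Measure.map_right_mul_eq_modularCharacterFun_smul mK w
  rw [← integral_map (measurable_mul_const w).aemeasurable
    hf.aestronglyMeasurable, h, integral_smul_nnreal_measure]
  rfl

theorem continuous_integral_of_locally_compact_support {F : K → K → ℝ}
    (hF : Continuous (Function.uncurry F))
    (hsupp : ∀ w₀, ∃ W ∈ 𝓝 w₀, ∃ C : Set K, IsCompact C ∧ ∀ w ∈ W, ∀ t ∉ C, F w t = 0) :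
    Continuous fun w => ∫ t, F w t ∂mK := by
  rw [continuous_iff_continuousAt]
  intro w₀
  obtain ⟨W, hW, C, hC, h0⟩ := hsupp w₀
  exact (continuousOn_integral_of_compact_support hC hF.continuousOn
    fun w t hw ht => h0 w hw t ht).continuousAt hW

theorem locally_compact_support_mul_right (k : C_c(K, ℝ)) (w₀ : K) :
    ∃ W ∈ 𝓝 w₀, ∃ C : Set K, IsCompact C ∧ ∀ w ∈ W, ∀ t ∉ C, k (t * w) = 0 := by
  obtain ⟨W, hW, hWn⟩ := exists_compact_mem_nhds w₀
  refine ⟨W, hWn, tsupport k * W⁻¹, k.hasCompactSupport.isCompact.mul hW.inv, fun w hw t ht => ?_⟩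
  refine image_eq_zero_of_notMem_tsupport fun hmem => ht ?_
  exact ⟨t * w, hmem, w⁻¹, Set.inv_mem_inv.2 hw, by simp⟩

theorem exists_compactlySupported_integral_eq_one :
    ∃ k : C_c(K, ℝ), (∀ t, 0 ≤ k t) ∧ ∫ t, k t ∂mK = 1 := by
  obtain ⟨f, hfc, hf0, hf1⟩ := exists_continuous_nonneg_pos (1 : K)
  have hpos : 0 < ∫ t, f t ∂mK :=
    f.continuous.integral_pos_of_hasCompactSupport_nonneg_nonzero hfc hf0 hf1
  refine ⟨(∫ t, f t ∂mK)⁻¹ • (⟨f, hfc⟩ : C_c(K, ℝ)), fun t => ?_, ?_⟩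
  · exact mul_nonneg (inv_nonneg.2 hpos.le) (hf0 t)
  · change ∫ t, (∫ t, f t ∂mK)⁻¹ * f t ∂mK = 1
    rw [integral_const_mul, inv_mul_cancel₀ hpos.ne']

/-- For `k` of integral one the character is `w ↦ ∫ k(t w) dt`, and for `w` near a given point all
integrands are supported in one compact set. -/
theorem continuous_modularCharacterFun :
    Continuous fun w : K => (Measure.modularCharacterFun w : ℝ) := by
  obtain ⟨k, -, hk1⟩ := exists_compactlySupported_integral_eq_one (Measure.haar (G := K))
  have h : ∀ w : K, (Measure.modularCharacterFun w : ℝ) = ∫ t, k (t * w) ∂Measure.haar := by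
    intro w
    rw [integral_mul_right_eq_smul _ (map_continuous k) w, hk1, smul_eq_mul, mul_one]
  simp_rw [h]
  exact continuous_integral_of_locally_compact_support _
    ((map_continuous k).comp (continuous_snd.mul continuous_fst))
    (locally_compact_support_mul_right k)

/-- The right translate of a weight, normalised so that the integral is preserved. -/
def weightTranslate (k : C_c(K, ℝ)) (w : K) : C_c(K, ℝ) :=
  (Measure.modularCharacterFun w : ℝ) • compHomeomorph k (Homeomorph.mulRight w⁻¹)

theorem weightTranslate_apply (k : C_c(K, ℝ)) (w t : K) :
    weightTranslate k w t = (Measure.modularCharacterFun w : ℝ) * k (t * w⁻¹) := rfl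

theorem modularCharacterFun_inv_mul_self (w : K) :
    (Measure.modularCharacterFun w⁻¹ : ℝ) * (Measure.modularCharacterFun w : ℝ) = 1 := by
  rw [← NNReal.coe_mul, ← Measure.modularCharacterFun_map_mul, inv_mul_cancel,
    Measure.modularCharacterFun_map_one, NNReal.coe_one]

/-- Averages with the translated weight. -/
theorem average_weightTranslate {B : Type*} [NormedAddCommGroup B] [NormedSpace ℝ B] {q : K → B}
    (hq : Continuous q) (k : C_c(K, ℝ)) (w u : K) :
    average mK q (weightTranslate k w) u = ∫ t, k t • q (w⁻¹ * (t⁻¹ * u)) ∂mK := by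
  have hc : Continuous fun t => k t • q (w⁻¹ * (t⁻¹ * u)) :=
    (map_continuous k).smul (hq.comp (continuous_const.mul (continuous_inv.mul continuous_const)))
  have h := integral_mul_right_eq_smul mK hc w⁻¹
  rw [average]
  simp_rw [weightTranslate_apply, mul_smul]
  rw [integral_smul]
  have e : ∀ t, k (t * w⁻¹) • q (w⁻¹ * ((t * w⁻¹)⁻¹ * u)) = k (t * w⁻¹) • q (t⁻¹ * u) := by
    intro t
    congr 2
    group
  simp_rw [e] at h
  rw [h, smul_smul, mul_comm, modularCharacterFun_inv_mul_self, one_smul]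

theorem integral_weightTranslate (k : C_c(K, ℝ)) (w : K) :
    ∫ t, weightTranslate k w t ∂mK = ∫ t, k t ∂mK := by
  have h := average_weightTranslate mK (q := fun _ : K => (1 : ℝ)) continuous_const k w 1
  simpa [average] using h

theorem continuous_integral_abs_weightTranslate_sub (k : C_c(K, ℝ)) (w₀ : K) :
    Continuous fun w => ∫ t, |(weightTranslate k w - weightTranslate k w₀) t| ∂mK := by
  refine continuous_integral_of_locally_compact_support mK
    (F := fun w t => |(weightTranslate k w - weightTranslate k w₀) t|) ?_ fun w₁ => ?_
  · simp only [Function.uncurry_def, CompactlySupportedContinuousMap.coe_sub, Pi.sub_apply,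
      weightTranslate_apply]
    refine (Continuous.sub ?_ ?_).abs
    · exact (continuous_modularCharacterFun.comp continuous_fst).mul
        ((map_continuous k).comp (continuous_snd.mul continuous_fst.inv))
    · exact continuous_const.mul ((map_continuous k).comp (continuous_snd.mul continuous_const))
  · obtain ⟨W, hW, C, hC, h0⟩ := locally_compact_support_mul_right k w₁⁻¹
    obtain ⟨W', hW', C', hC', h0'⟩ := locally_compact_support_mul_right k w₀⁻¹
    refine ⟨W⁻¹, continuous_inv.tendsto w₁ hW, C ∪ C', hC.union hC', fun w hw t ht => ?_⟩
    rw [Set.mem_union, not_or] at ht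
    rw [CompactlySupportedContinuousMap.coe_sub, Pi.sub_apply, weightTranslate_apply,
      weightTranslate_apply, h0 w⁻¹ hw t ht.1, h0' w₀⁻¹ (mem_of_mem_nhds hW') t ht.2]
    simp

/-- Abstract form of Reiter's property for an isometric action of an amenable group. -/
theorem exists_almost_invariant (hK : IsAmenable K) {B : Type*}
    [NormedAddCommGroup B] [NormedSpace ℝ B] [CompleteSpace B] {q : K → B} (hq : Continuous q)
    (hq1 : ∀ u, ‖q u‖ ≤ 1) (ℓ : StrongDual ℝ B) (hℓ : ∀ u, ℓ (q u) = 1) (U : K → B →L[ℝ] B)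
    (hU : ∀ w u, U w (q u) = q (w⁻¹ * u)) {C : Set K} (hC : IsCompact C) {ε : ℝ} (hε : 0 < ε) :
    ∃ φ : B, ‖φ‖ ≤ 1 ∧ ℓ φ = 1 ∧ ∀ w ∈ C, ‖U w φ - φ‖ < ε := by
  obtain ⟨mK, hmK⟩ : ∃ m : Measure K, m.IsHaarMeasure := ⟨Measure.haar, inferInstance⟩
  obtain ⟨k, hk0, hk1⟩ := exists_compactlySupported_integral_eq_one mK
  -- Translated weights vary continuously in `L¹`, so finitely many such neighbourhoods cover `C`.
  -- This reduces uniformity on `C` to finitely many centres.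
  set V : K → Set K := fun w₀ =>
    {w | ∫ t, |(weightTranslate k w - weightTranslate k w₀) t| ∂mK < ε / 2} with hV
  have hVn : ∀ w₀ ∈ C, V w₀ ∈ 𝓝 w₀ := fun w₀ _ => by
    refine (continuous_integral_abs_weightTranslate_sub mK k w₀).continuousAt.eventually_lt_const ?_
    simpa using half_pos hε
  obtain ⟨T, -, hT⟩ := hC.elim_nhds_subcover V hVn
  -- One convex combination serves every centre in `T`; the differences have integral zero because
  -- `weightTranslate` preserves the integral.
  obtain ⟨s, c, hc0, hc1, hsmall⟩ := exists_convex_combination_average_small mK hK hq hq1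
    (J := T) (fun w => weightTranslate k w - k) (fun w => by
      change ∫ t, (weightTranslate k w t - k t) ∂mK = 0
      rw [integral_sub (CompactlySupportedContinuousMap.integrable _) k.integrable,
        integral_weightTranslate, sub_self]) (half_pos hε)
  set Φ : C_c(K, ℝ) → B := fun l => ∑ u ∈ s, c u • average mK q l u with hΦ
  have hΦsub : ∀ l l', Φ (l - l') = Φ l - Φ l' := fun l l' => by
    simp only [hΦ, average_sub mK hq, smul_sub, Finset.sum_sub_distrib]
  have hΦle : ∀ l, ‖Φ l‖ ≤ ∫ t, |l t| ∂mK := fun l => by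
    calc ‖Φ l‖ ≤ ∑ u ∈ s, c u * ∫ t, |l t| ∂mK := by
          refine norm_sum_le_of_le _ fun u hu => ?_
          rw [norm_smul, Real.norm_of_nonneg (hc0 u hu)]
          refine mul_le_mul_of_nonneg_left ?_ (hc0 u hu)
          simpa using norm_average_le mK hq1 l u
      _ = _ := by rw [← Finset.sum_mul, hc1, one_mul]
  -- The operator `U w` acts on an average by translating its weight, so near-invariance of `Φ k`
  -- becomes smallness of `Φ` on differences of weights.
  have hΦU : ∀ w, U w (Φ k) = Φ (weightTranslate k w) := fun w => by
    simp only [hΦ, map_sum, map_smul]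
    refine Finset.sum_congr rfl fun u _ => ?_
    rw [average_weightTranslate mK hq, average,
      ← ContinuousLinearMap.integral_comp_comm _ (integrable_smul_translate mK hq k u)]
    simp_rw [map_smul, hU]
  refine ⟨Φ k, ?_, ?_, fun w hw => ?_⟩
  · refine (hΦle k).trans (le_of_eq ?_)
    rw [← hk1]
    exact integral_congr_ae (Filter.Eventually.of_forall fun t => abs_of_nonneg (hk0 t))
  · have : ∀ u, ℓ (average mK q k u) = 1 := fun u => by
      rw [average, ← ContinuousLinearMap.integral_comp_comm _ (integrable_smul_translate mK hq k u)]
      simp_rw [map_smul, hℓ, smul_eq_mul, mul_one, hk1]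
    simp only [hΦ, map_sum, map_smul, this, smul_eq_mul, mul_one, hc1]
  · obtain ⟨w₀, hw₀, hmem⟩ := Set.mem_iUnion₂.1 (hT hw)
    have e : U w (Φ k) - Φ k =
        Φ (weightTranslate k w - weightTranslate k w₀) + Φ (weightTranslate k w₀ - k) := by
      rw [hΦU, hΦsub, hΦsub]
      abel
    rw [e]
    refine (norm_add_le _ _).trans_lt ?_
    have h1 := (hΦle (weightTranslate k w - weightTranslate k w₀)).trans_lt hmem
    have h2 := hsmall ⟨w₀, hw₀⟩
    exact (add_lt_add h1 h2).trans_eq (add_halves ε)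

/-- An instance of `exists_almost_invariant` in `L¹(K)`: `q` runs through the left translates of a
density, `ℓ` is the integral and `U w` is translation. -/
theorem exists_reiter (hK : IsAmenable K) {C : Set K} (hC : IsCompact C) {ε : ℝ} (hε : 0 < ε) :
    ∃ f : K → ℝ, Measurable f ∧ (∀ s, 0 ≤ f s) ∧ ∫⁻ s, ‖f s‖ₑ ∂mK = 1 ∧
      ∀ w ∈ C, ∫⁻ s, ‖f (w * s) - f s‖ₑ ∂mK ≤ ENNReal.ofReal ε := by
  obtain ⟨k, hk0, hk1⟩ := exists_compactlySupported_integral_eq_one mK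
  have : Fact ((1 : ℝ≥0∞) ≠ ∞) := ⟨ENNReal.one_ne_top⟩
  have hkL : MemLp k 1 mK := memLp_one_iff_integrable.2 k.integrable
  set φ₀ : Lp ℝ 1 mK := hkL.toLp k with hφ₀
  have hint : ∀ (w : K) (φ : Lp ℝ 1 mK),
      ∫ s, (DomMulAct.mk w • φ : Lp ℝ 1 mK) s ∂mK = ∫ s, φ s ∂mK := by
    intro w φ
    rw [← integral_mul_left_eq_self (fun s => φ s) w]
    exact integral_congr_ae (DomMulAct.smul_Lp_ae_eq (DomMulAct.mk w) φ)
  set ℓ : StrongDual ℝ (Lp ℝ 1 mK) := L1.integralCLM with hℓ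
  have hℓ_apply : ∀ φ : Lp ℝ 1 mK, ℓ φ = ∫ s, φ s ∂mK := fun φ => by
    rw [hℓ, ← L1.integral_eq, L1.integral_eq_integral]
  have hnorm : ∀ φ : Lp ℝ 1 mK, ‖φ‖ = ∫ s, ‖φ s‖ ∂mK := L1.norm_eq_integral_norm
  let U : K → Lp ℝ 1 mK →L[ℝ] Lp ℝ 1 mK := fun w =>
    LinearMap.mkContinuous
      { toFun := fun φ => DomMulAct.mk w • φ
        map_add' := fun φ ψ => DomMulAct.smul_Lp_add _ φ ψ
        map_smul' := fun c φ => smul_comm _ c φ } 1 fun φ => by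
          simp [DomMulAct.norm_smul_Lp]
  obtain ⟨φ, hφ1, hℓφ, hφC⟩ := exists_almost_invariant hK
    (q := fun u => DomMulAct.mk u⁻¹ • φ₀)
    ((DomMulAct.continuous_mk.comp continuous_inv).smul continuous_const)
    (fun u => by
      rw [DomMulAct.norm_smul_Lp, hnorm]
      refine le_of_eq (Eq.trans ?_ hk1)
      refine integral_congr_ae (hkL.coeFn_toLp.mono fun s hs => ?_)
      simp only [hφ₀, hs, Real.norm_of_nonneg (hk0 s)])
    ℓ (fun u => by
      rw [hℓ_apply, hint, ← hk1]
      exact integral_congr_ae hkL.coeFn_toLp) U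
    (fun w u => by
      change DomMulAct.mk w • DomMulAct.mk u⁻¹ • φ₀ = _
      rw [smul_smul, ← DomMulAct.mk_mul]
      simp) hC hε
  have hmeas : Measurable φ := (Lp.stronglyMeasurable φ).measurable
  -- Integral one and norm at most one force norm exactly one. Taking absolute values keeps the norm
  -- and does not increase the distance to translates.
  refine ⟨fun s => |φ s|, hmeas.abs, fun s => abs_nonneg _, ?_, fun w hw => ?_⟩
  · have h1 : (∫⁻ s, ‖φ s‖ₑ ∂mK) = ENNReal.ofReal ‖φ‖ := by
      rw [hnorm, ofReal_integral_norm_eq_lintegral_enorm (L1.integrable_coeFn φ)]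
    have h2 : 1 ≤ ‖φ‖ := by
      rw [← hℓφ, hℓ_apply, hnorm]
      exact (Real.le_norm_self _).trans (norm_integral_le_integral_norm _)
    simp_rw [← Real.norm_eq_abs, enorm_norm]
    rw [h1, le_antisymm hφ1 h2, ENNReal.ofReal_one]
  · have h1 := hφC w hw
    have h2 : ENNReal.ofReal ‖U w φ - φ‖ = ∫⁻ s, ‖φ (w * s) - φ s‖ₑ ∂mK := by
      rw [hnorm, ofReal_integral_norm_eq_lintegral_enorm (L1.integrable_coeFn _)]
      refine lintegral_congr_ae ?_
      filter_upwards [Lp.coeFn_sub (U w φ) φ, DomMulAct.smul_Lp_ae_eq (DomMulAct.mk w) φ]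
        with s hs1 hs2
      rw [hs1, Pi.sub_apply]
      congr 2
    calc ∫⁻ s, ‖|φ (w * s)| - |φ s|‖ₑ ∂mK ≤ ∫⁻ s, ‖φ (w * s) - φ s‖ₑ ∂mK := by
          refine lintegral_mono fun s => ?_
          rw [← ofReal_norm, ← ofReal_norm]
          exact ENNReal.ofReal_le_ofReal (abs_abs_sub_abs_le_abs_sub _ _)
      _ ≤ ENNReal.ofReal ε := by
          rw [← h2]
          exact ENNReal.ofReal_le_ofReal h1.le

end Reiter

/-! ### Equivariant extension from `G ⧸ S` to `G`. -/

section Transference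

/-- Superadditivity of `t ↦ t^q` on nonnegative numbers. It turns `L¹` near-invariance of `f` into
`L^p` near-invariance of `f^(1/p)`. -/
theorem abs_rpow_sub_rpow_rpow_le {q : ℝ} (hq : 1 ≤ q) {a b : ℝ} (ha : 0 ≤ a) (hb : 0 ≤ b) :
    |a ^ (1 / q) - b ^ (1 / q)| ^ q ≤ |a - b| := by
  have key : ∀ a b : ℝ, 0 ≤ b → b ≤ a → |a ^ (1 / q) - b ^ (1 / q)| ^ q ≤ |a - b| := by
    intro a b hb hab
    have ha : 0 ≤ a := hb.trans hab
    have h1 : b ^ (1 / q) ≤ a ^ (1 / q) := Real.rpow_le_rpow hb hab (by positivity)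
    have h2 := Real.add_rpow_le_rpow_add (sub_nonneg.2 h1) (Real.rpow_nonneg hb (1 / q)) hq
    have hqq : 1 / q * q = 1 := by field_simp
    rw [sub_add_cancel, ← Real.rpow_mul ha, ← Real.rpow_mul hb, hqq, Real.rpow_one,
      Real.rpow_one] at h2
    rw [abs_of_nonneg (sub_nonneg.2 h1), abs_of_nonneg (sub_nonneg.2 hab)]
    linarith
  rcases le_total b a with h | h
  · exact key a b hb h
  · rw [abs_sub_comm, abs_sub_comm a b]
    exact key b a ha h

theorem exists_isCompact_measure_compl_le {α : Type*} [TopologicalSpace α] [T2Space α]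
    [SigmaCompactSpace α] [MeasurableSpace α] [OpensMeasurableSpace α] (m : Measure α)
    [IsFiniteMeasure m] {ε : ℝ≥0∞} (hε : ε ≠ 0) : ∃ C : Set α, IsCompact C ∧ m Cᶜ ≤ ε := by
  have h1 := tendsto_measure_iInter_atTop (μ := m) (s := fun n => (compactCovering α n)ᶜ)
    (fun n => (isCompact_compactCovering α n).measurableSet.compl.nullMeasurableSet)
    (fun i j hij => Set.compl_subset_compl.2 (compactCovering_subset α hij))
    ⟨0, measure_ne_top _ _⟩
  rw [← Set.compl_iUnion, iUnion_compactCovering, Set.compl_univ, measure_empty] at h1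
  obtain ⟨n, hn⟩ := (h1.eventually_lt_const (pos_iff_ne_zero.2 hε)).exists
  exact ⟨_, isCompact_compactCovering α n, hn.le⟩

variable {G : Type*} [Group G] [TopologicalSpace G] [IsTopologicalGroup G]
  [LocallyCompactSpace G] [T2Space G] [SecondCountableTopology G]
  [MeasurableSpace G] [BorelSpace G] {S : Subgroup G} [IsClosed (S : Set G)]
  {σ : CrossSection S} {mG : Measure G} {mS : Measure S}
  {ν : Measure (G ⧸ S)} [mG.IsHaarMeasure] [mS.IsHaarMeasure]
  {p : ℝ≥0∞} [hp1 : Fact (1 ≤ p)]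
  {X : Type*} [NormedAddCommGroup X] [NormedSpace ℂ X]
  {ρ : S →* (X ≃ₗᵢ[ℂ] X)}

/-- The function on `G` obtained from `ξ` by extending it equivariantly and cutting off by `φ` in
the direction of `S`. -/
def cutoffExtension (σ : CrossSection S) (ρ : S →* (X ≃ₗᵢ[ℂ] X)) (p : ℝ≥0∞) (φ : S → ℝ)
    (ξ : G ⧸ S → X) (g : G) : X :=
  (((modularRatio S (σ.tau g) : ℝ) ^ (-(1 / p.toReal)) : ℝ) : ℂ) •
    ρ (σ.tau g)⁻¹ ((φ (σ.tau g) : ℂ) • ξ (g : G ⧸ S))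

theorem stronglyMeasurable_cutoffExtension (hρ : ∀ x : X, Continuous fun s : S => ρ s x)
    {φ : S → ℝ} (hφ : Measurable φ) {ξ : G ⧸ S → X} (hξ : StronglyMeasurable ξ) :
    StronglyMeasurable (cutoffExtension σ ρ p φ ξ) := by
  refine StronglyMeasurable.smul
    ((measurable_modularRatio_rpow _).comp σ.measurable_tau).stronglyMeasurable ?_
  refine stronglyMeasurable_isometric_action hρ σ.measurable_tau.inv (StronglyMeasurable.smul ?_
    (hξ.comp_measurable CrossSection.measurable_mk))
  exact (Complex.measurable_ofReal.comp (hφ.comp σ.measurable_tau)).stronglyMeasurable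

theorem cutoffExtension_mul (φ : S → ℝ) (ξ : G ⧸ S → X) (g : G) (s : S) :
    cutoffExtension σ ρ p φ ξ (g * s) =
      (((modularRatio S s : ℝ) ^ (-(1 / p.toReal)) : ℝ) : ℂ) • ρ s⁻¹
        ((φ (σ.tau g * s) : ℂ) • (((modularRatio S (σ.tau g) : ℝ) ^ (-(1 / p.toReal)) : ℝ) : ℂ) •
          ρ (σ.tau g)⁻¹ (ξ (g : G ⧸ S))) := by
  simp only [cutoffExtension, σ.tau_mul, CrossSection.mk_mul, modularRatio_mul, mul_inv_rev,
    map_mul, map_smul, LinearIsometryEquiv.coe_mul, Function.comp_apply, NNReal.coe_mul]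
  rw [Real.mul_rpow (NNReal.coe_nonneg _) (NNReal.coe_nonneg _), Complex.ofReal_mul]
  simp only [smul_smul]
  congr 1
  ring

/-- The link between the two representations: translating the extension by `k` produces `inducedRep`
at `k`, apart from the shifted cut-off and a twist by `s` that does not depend on `k`. -/
theorem cutoffExtension_inv_mul (φ : S → ℝ) (ξ : G ⧸ S → X) (k : G) (x : G ⧸ S) (s : S) :
    cutoffExtension σ ρ p φ ξ (k⁻¹ * (σ.toFun x * s)) =
      (((modularRatio S s : ℝ) ^ (-(1 / p.toReal)) : ℝ) : ℂ) • ρ s⁻¹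
        ((φ (σ.tau₂ k x * s) : ℂ) • inducedRep σ ρ p k ξ x) := by
  rw [← mul_assoc, cutoffExtension_mul]
  rfl

theorem coe_modularRatio_ne_zero (s : S) : (modularRatio S s : ℝ≥0∞) ≠ 0 := by
  simpa using modularRatio_ne_zero s

theorem enorm_isometry (s : S) (x : X) : ‖ρ s x‖ₑ = ‖x‖ₑ := by
  rw [← ofReal_norm, LinearIsometryEquiv.norm_map, ofReal_norm]

/-- The twist by `s` exactly cancels the density `Δ` in the disintegration of `mG`. -/
theorem enorm_twist_rpow (hp : p ≠ ∞) (s : S) (x : X) :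
    ‖(((modularRatio S s : ℝ) ^ (-(1 / p.toReal)) : ℝ) : ℂ) • ρ s⁻¹ x‖ₑ ^ p.toReal *
      (modularRatio S s : ℝ≥0∞) = ‖x‖ₑ ^ p.toReal := by
  rw [enorm_modularRatio_rpow_smul hp, enorm_isometry, mul_right_comm,
    ENNReal.inv_mul_cancel (coe_modularRatio_ne_zero s) ENNReal.coe_ne_top, one_mul]

theorem lintegral_cutoffExtension (hν : IsQuotientMeasure σ mG mS ν) (hp : p ≠ ∞)
    (hρ : ∀ x : X, Continuous fun s : S => ρ s x)
    {φ : S → ℝ} (hφ : Measurable φ) (hφ1 : ∫⁻ s, ‖φ s‖ₑ ^ p.toReal ∂mS = 1) {ξ : G ⧸ S → X}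
    (hξ : StronglyMeasurable ξ) :
    ∫⁻ g, ‖cutoffExtension σ ρ p φ ξ g‖ₑ ^ p.toReal ∂mG = ∫⁻ x, ‖ξ x‖ₑ ^ p.toReal ∂ν := by
  have hq := one_le_toReal hp
  rw [hν.lintegral_eq _ ((stronglyMeasurable_cutoffExtension hρ hφ hξ).enorm.pow_const _)]
  refine lintegral_congr fun x => ?_
  have h : ∀ s : S, ‖cutoffExtension σ ρ p φ ξ (σ.toFun x * s)‖ₑ ^ p.toReal *
      (modularRatio S s : ℝ≥0∞) = ‖φ s‖ₑ ^ p.toReal * ‖ξ x‖ₑ ^ p.toReal := fun s => by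
    rw [cutoffExtension, σ.tau_toFun_mul, CrossSection.mk_mul, σ.mk_toFun, enorm_twist_rpow hp,
      enorm_smul, ENNReal.mul_rpow_of_nonneg _ _ (by linarith)]
    congr 2
    rw [← ofReal_norm, Complex.norm_real, ofReal_norm]
  simp_rw [h]
  rw [lintegral_mul_const _ (hφ.enorm.pow_const _), hφ1, one_mul]

/-- The integrated form of the induced representation, with an additional cut-off weight. -/
def cutoffIntegral (σ : CrossSection S) (ρ : S →* (X ≃ₗᵢ[ℂ] X)) (p : ℝ≥0∞) (μ : ComplexMeasure G)
    (φ : S → ℝ) (ξ : G ⧸ S → X) (z : (G ⧸ S) × S) : X :=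
  cintegral μ fun k => (φ (σ.tau₂ k z.1 * z.2) : ℂ) • inducedRep σ ρ p k ξ z.1

theorem stronglyMeasurable_cutoffIntegrand (hν : IsQuotientMeasure σ mG mS ν) (hp : p ≠ ∞)
    (hρ : ∀ x : X, Continuous fun s : S => ρ s x)
    {φ : S → ℝ} (hφ : Measurable φ) {ξ : G ⧸ S → X} (hξ : StronglyMeasurable ξ) :
    StronglyMeasurable fun y : ((G ⧸ S) × S) × G =>
      (φ (σ.tau₂ y.2 y.1.1 * y.1.2) : ℂ) • inducedRep σ ρ p y.2 ξ y.1.1 := by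
  have hm : Measurable fun y : ((G ⧸ S) × S) × G => (y.1.1, y.2) :=
    (measurable_fst.comp measurable_fst).prodMk measurable_snd
  have h0 : StronglyMeasurable fun z : (G ⧸ S) × G => inducedRep σ ρ p z.2 ξ z.1 :=
    (isMeasurableIsometric_inducedRep hν hp hρ).stronglyMeasurable ξ hξ
  have h1 := h0.comp_measurable hm
  have h2 := σ.measurable_tau₂.comp hm
  have h3 := h2.mul (measurable_snd.comp measurable_fst)
  have h4 := Complex.measurable_ofReal.comp (hφ.comp h3)
  exact h4.stronglyMeasurable.smul h1

variable [CompleteSpace X]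

/-- The twist by `s` is invertible and independent of `k`, so it passes through the integral over
`k`; this transfers integrability, and the twist then disappears from the norm by
`enorm_twist_rpow`. -/
theorem ae_cutoffIntegral (hν : IsQuotientMeasure σ mG mS ν) (hp : p ≠ ∞)
    {μ : ComplexMeasure G} {L : Lp X p mG →L[ℂ] Lp X p mG}
    (hL : IsIntegratedForm leftRegular μ p mG L)
    {φ : S → ℝ} {ξ : G ⧸ S → X} (hF : MemLp (cutoffExtension σ ρ p φ ξ) p mG) :
    ∀ᵐ x ∂ν, ∀ᵐ s ∂mS,
      Integrable (fun k => (φ (σ.tau₂ k x * s) : ℂ) • inducedRep σ ρ p k ξ x) μ.variation ∧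
      ‖L (hF.toLp _) (σ.toFun x * (s : G))‖ₑ ^ p.toReal * (modularRatio S s : ℝ≥0∞) =
        ‖cutoffIntegral σ ρ p μ φ ξ (x, s)‖ₑ ^ p.toReal := by
  filter_upwards [hν.ae_of_ae (hL _ hF)] with x hx
  filter_upwards [hx] with s hs
  obtain ⟨hint, heq⟩ := hs
  set c : ℂ := (((modularRatio S s : ℝ) ^ (-(1 / p.toReal)) : ℝ) : ℂ) with hc
  have hc0 : c ≠ 0 := by
    rw [hc, Ne, Complex.ofReal_eq_zero]
    exact (Real.rpow_pos_of_pos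
      (NNReal.coe_pos.2 (pos_iff_ne_zero.2 (modularRatio_ne_zero s))) _).ne'
  have hfun : (fun k => leftRegular k (cutoffExtension σ ρ p φ ξ) (σ.toFun x * (s : G))) =
      fun k => c • ρ s⁻¹ ((φ (σ.tau₂ k x * s) : ℂ) • inducedRep σ ρ p k ξ x) := by
    ext k
    exact cutoffExtension_inv_mul φ ξ k x s
  rw [hfun] at hint heq
  have hint' : Integrable (fun k => (φ (σ.tau₂ k x * s) : ℂ) • inducedRep σ ρ p k ξ x)
      μ.variation := by
    have h1 := ((ρ s : X ≃ₗᵢ[ℂ] X).toContinuousLinearEquiv : X →L[ℂ] X).integrable_comp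
      ((MeasureTheory.Integrable.smul c⁻¹ hint))
    refine h1.congr (Filter.Eventually.of_forall fun k => ?_)
    simp only [Pi.smul_apply, inv_smul_smul₀ hc0]
    change (ρ s * ρ s⁻¹) _ = _
    rw [← map_mul, mul_inv_cancel, map_one]
    rfl
  refine ⟨hint', ?_⟩
  have h2 : L (hF.toLp _) (σ.toFun x * (s : G)) =
      c • ρ s⁻¹ (cutoffIntegral σ ρ p μ φ ξ (x, s)) := by
    rw [heq]
    have h3 := cintegral_comp_clm ((ρ s⁻¹ : X ≃ₗᵢ[ℂ] X).toContinuousLinearEquiv : X →L[ℂ] X) hint'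
    have h4 := cintegral_smul (μ := μ) c
      (fun k => ρ s⁻¹ ((φ (σ.tau₂ k x * s) : ℂ) • inducedRep σ ρ p k ξ x))
    exact h4.trans (congrArg (c • ·) h3)
  rw [h2]
  exact enorm_twist_rpow hp s _

end Transference

/-! ### The transference inequality. -/

section TransferenceBound

theorem eLpNorm_eq_of_lintegral_rpow_eq {α β E F : Type*} [MeasurableSpace α] [MeasurableSpace β]
    [NormedAddCommGroup E] [NormedAddCommGroup F] {m : Measure α} {n : Measure β} {p : ℝ≥0∞}
    [Fact (1 ≤ p)] (hp : p ≠ ∞) {f : α → E} {g : β → F}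
    (h : ∫⁻ a, ‖f a‖ₑ ^ p.toReal ∂m = ∫⁻ b, ‖g b‖ₑ ^ p.toReal ∂n) :
    eLpNorm f p m = eLpNorm g p n := by
  rw [← eLpNorm_rpow_toReal hp, ← eLpNorm_rpow_toReal hp] at h
  exact ENNReal.rpow_left_injective (by have := one_le_toReal hp; linarith) h

theorem eLpNorm_clm_le {α E F : Type*} [MeasurableSpace α] [NormedAddCommGroup E]
    [NormedAddCommGroup F] [NormedSpace ℂ E] [NormedSpace ℂ F] {m : Measure α} {p : ℝ≥0∞}
    [Fact (1 ≤ p)] (L : Lp E p m →L[ℂ] Lp F p m) (f : Lp E p m) :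
    eLpNorm (L f) p m ≤ ‖L‖ₑ * eLpNorm f p m := by
  have := L.le_opENorm f
  rwa [Lp.enorm_def, Lp.enorm_def] at this

theorem enorm_rpow_inv_rpow {q : ℝ} (hq : 1 ≤ q) {a : ℝ} (ha : 0 ≤ a) :
    ‖a ^ (1 / q)‖ₑ ^ q = ‖a‖ₑ := by
  rw [Real.enorm_of_nonneg (Real.rpow_nonneg ha _), Real.enorm_of_nonneg ha,
    ENNReal.ofReal_rpow_of_nonneg (Real.rpow_nonneg ha _) (by linarith), ← Real.rpow_mul ha,
    one_div, inv_mul_cancel₀ (by linarith), Real.rpow_one]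

theorem enorm_rpow_sub_rpow_rpow_le {q : ℝ} (hq : 1 ≤ q) {a b : ℝ} (ha : 0 ≤ a) (hb : 0 ≤ b) :
    ‖a ^ (1 / q) - b ^ (1 / q)‖ₑ ^ q ≤ ‖a - b‖ₑ := by
  rw [← ofReal_norm, ← ofReal_norm, ENNReal.ofReal_rpow_of_nonneg (norm_nonneg _) (by linarith)]
  exact ENNReal.ofReal_le_ofReal (abs_rpow_sub_rpow_rpow_le hq ha hb)

/-- The order of quantifiers matters: `C` is fixed before `D`, because `D` will be built from a
Reiter function that depends on `C`. -/
theorem exists_isCompact_lintegral_le {α : Type*} [TopologicalSpace α] [T2Space α]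
    [SigmaCompactSpace α] [MeasurableSpace α] [OpensMeasurableSpace α] (m : Measure α)
    [IsFiniteMeasure m] {ε : ℝ≥0∞} (hε : ε ≠ 0) : ∃ C : Set α, IsCompact C ∧
      ∀ (D : α → ℝ≥0∞) (b : ℝ≥0∞), (∀ t, D t ≤ b) → (∀ t ∈ C, D t ≤ ε) →
        ∫⁻ t, D t ∂m ≤ (m Set.univ + b) * ε := by
  obtain ⟨C, hC, hCε⟩ := exists_isCompact_measure_compl_le m hε
  refine ⟨C, hC, fun D b hb hD => ?_⟩
  calc ∫⁻ t, D t ∂m = ∫⁻ t in C, D t ∂m + ∫⁻ t in Cᶜ, D t ∂m :=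
        (lintegral_add_compl _ hC.measurableSet).symm
    _ ≤ ∫⁻ t in C, ε ∂m + ∫⁻ t in Cᶜ, b ∂m :=
        add_le_add (setLIntegral_mono' hC.measurableSet hD) (lintegral_mono hb)
    _ ≤ ε * m Set.univ + b * ε := by
        rw [setLIntegral_const, setLIntegral_const]
        gcongr
        exact Set.subset_univ _
    _ = _ := by ring

variable {G : Type*} [Group G] [TopologicalSpace G] [IsTopologicalGroup G]
  [LocallyCompactSpace G] [T2Space G] [SecondCountableTopology G]
  [MeasurableSpace G] [BorelSpace G] {S : Subgroup G} [IsClosed (S : Set G)]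
  {σ : CrossSection S} {mG : Measure G} {mS : Measure S}
  {ν : Measure (G ⧸ S)} [mG.IsHaarMeasure] [mS.IsHaarMeasure]
  {p : ℝ≥0∞} [hp1 : Fact (1 ≤ p)]
  {X : Type*} [NormedAddCommGroup X] [NormedSpace ℂ X]
  {ρ : S →* (X ≃ₗᵢ[ℂ] X)}

theorem lintegral_enorm_translate_sub_le_two {f : S → ℝ} (hf : Measurable f)
    (hf1 : ∫⁻ s, ‖f s‖ₑ ∂mS = 1) (t : S) : ∫⁻ s, ‖f (t * s) - f s‖ₑ ∂mS ≤ 2 := by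
  calc ∫⁻ s, ‖f (t * s) - f s‖ₑ ∂mS ≤ ∫⁻ s, ‖f (t * s)‖ₑ + ‖f s‖ₑ ∂mS :=
        lintegral_mono fun s => enorm_sub_le
    _ = 2 := by
        rw [lintegral_add_right _ hf.enorm, lintegral_mul_left_eq_self (fun s => ‖f s‖ₑ) t, hf1]
        norm_num

/-- The pointwise error `B - A`: Hölder in `k`, then `enorm_rpow_sub_rpow_rpow_le` for the two
cut-off factors. -/
theorem enorm_smul_cintegral_sub_cutoffIntegral_rpow_le (hp : p ≠ ∞) (μ : ComplexMeasure G)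
    {f : S → ℝ} (hf0 : ∀ s, 0 ≤ f s) {ξ : G ⧸ S → X}
    {x : G ⧸ S} {s : S} (h1 : Integrable (fun k => inducedRep σ ρ p k ξ x) μ.variation)
    (h2 : Integrable (fun k => ((f (σ.tau₂ k x * s) ^ (1 / p.toReal) : ℝ) : ℂ) •
      inducedRep σ ρ p k ξ x) μ.variation) :
    ‖((f s ^ (1 / p.toReal) : ℝ) : ℂ) • cintegral μ (fun k => inducedRep σ ρ p k ξ x) -
        cutoffIntegral σ ρ p μ (fun s => f s ^ (1 / p.toReal)) ξ (x, s)‖ₑ ^ p.toReal ≤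
      μ.variation Set.univ ^ (p.toReal - 1) *
        ∫⁻ k, ‖f (σ.tau₂ k x * s) - f s‖ₑ * ‖inducedRep σ ρ p k ξ x‖ₑ ^ p.toReal ∂μ.variation := by
  have hq := one_le_toReal hp
  set q := p.toReal
  have h3 := h1.smul (((f s ^ (1 / q) : ℝ) : ℂ))
  have h4 : ((f s ^ (1 / q) : ℝ) : ℂ) • cintegral μ (fun k => inducedRep σ ρ p k ξ x) -
      cutoffIntegral σ ρ p μ (fun s => f s ^ (1 / q)) ξ (x, s) =
      cintegral μ (fun k => ((f s ^ (1 / q) : ℝ) : ℂ) • inducedRep σ ρ p k ξ x -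
        ((f (σ.tau₂ k x * s) ^ (1 / q) : ℝ) : ℂ) • inducedRep σ ρ p k ξ x) := by
    rw [cutoffIntegral, ← cintegral_smul]
    exact (cintegral_sub h3 h2).symm
  rw [h4]
  refine (enorm_cintegral_rpow_le μ (h3.sub h2).aestronglyMeasurable hq).trans ?_
  refine mul_le_mul_right (lintegral_mono fun k => ?_) _
  simp only [Pi.sub_apply, Pi.smul_apply]
  rw [← sub_smul, enorm_smul, ENNReal.mul_rpow_of_nonneg _ _ (by linarith)]
  refine mul_le_mul_left ?_ _
  rw [← Complex.ofReal_sub, ← ofReal_norm, Complex.norm_real, ofReal_norm, ← enorm_neg, neg_sub]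
  exact enorm_rpow_sub_rpow_rpow_le hq (hf0 _) (hf0 _)

/-- The density `‖π(k)ξ(x)‖^p` defines a finite measure on pairs `(x, k)`. Its image under `τ` is a
finite measure on `S`, hence nearly concentrated on a compact set. -/
theorem exists_isCompact_lintegral_flow_le (hν : IsQuotientMeasure σ mG mS ν) (hp : p ≠ ∞)
    (hρ : ∀ x : X, Continuous fun s : S => ρ s x) (m : Measure G) [IsFiniteMeasure m]
    {ξ : G ⧸ S → X} (hξ : StronglyMeasurable ξ) (hξp : MemLp ξ p ν) {ε : ℝ≥0∞} (hε : ε ≠ 0) :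
    ∃ C : Set S, IsCompact C ∧ ∀ (D : S → ℝ≥0∞) (b : ℝ≥0∞), Measurable D → (∀ t, D t ≤ b) →
      (∀ t ∈ C, D t ≤ ε) →
      ∫⁻ x, ∫⁻ k, ‖inducedRep σ ρ p k ξ x‖ₑ ^ p.toReal * D (σ.tau₂ k x) ∂m ∂ν ≤
        (m Set.univ * ∫⁻ x, ‖ξ x‖ₑ ^ p.toReal ∂ν + b) * ε := by
  have := hν.sigmaFinite
  have hπ := isMeasurableIsometric_inducedRep hν hp hρ
  have hw := (hπ.stronglyMeasurable ξ hξ).enorm.pow_const p.toReal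
  set w : (G ⧸ S) × G → ℝ≥0∞ := fun z => ‖inducedRep σ ρ p z.2 ξ z.1‖ₑ ^ p.toReal with hwdef
  have htot : ∫⁻ z, w z ∂(ν.prod m) = m Set.univ * ∫⁻ x, ‖ξ x‖ₑ ^ p.toReal ∂ν := by
    rw [lintegral_prod _ hw.aemeasurable]
    exact hπ.lintegral_lintegral m hξ
  have hfin : ∫⁻ z, w z ∂(ν.prod m) ≠ ∞ := by
    rw [htot]
    exact ENNReal.mul_ne_top (measure_ne_top _ _) (lintegral_rpow_lt_top_of_memLp hp hξp).ne
  have hfm : IsFiniteMeasure ((ν.prod m).withDensity w) := isFiniteMeasure_withDensity hfin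
  set θ : Measure S := ((ν.prod m).withDensity w).map fun z => σ.tau₂ z.2 z.1 with hθ
  have hfθ : IsFiniteMeasure θ := Measure.isFiniteMeasure_map _ _
  have huniv : θ Set.univ = m Set.univ * ∫⁻ x, ‖ξ x‖ₑ ^ p.toReal ∂ν := by
    rw [hθ, Measure.map_apply σ.measurable_tau₂ MeasurableSet.univ, Set.preimage_univ,
      withDensity_apply _ MeasurableSet.univ, Measure.restrict_univ, htot]
  obtain ⟨C, hC, h⟩ := exists_isCompact_lintegral_le θ hε
  refine ⟨C, hC, fun D b hD hb hDC => ?_⟩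
  rw [← huniv]
  refine le_of_eq_of_le ?_ (h D b hb hDC)
  have hDm : Measurable fun z : (G ⧸ S) × G => D (σ.tau₂ z.2 z.1) := hD.comp σ.measurable_tau₂
  rw [hθ, lintegral_map hD σ.measurable_tau₂, lintegral_withDensity_eq_lintegral_mul _ hw hDm,
    lintegral_prod _ (hw.mul hDm).aemeasurable]
  rfl

/-- Triangle inequality for `B = A + (B - A)` on `(G ⧸ S) × S`. The norm of `B` is that of `T ξ`
because `φ` has `L^p` norm one, and the norm of `A` is that of `L` applied to the cut-off extension,
which has the norm of `ξ`. -/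
theorem enorm_le_of_isIntegratedForm [CompleteSpace X] (hν : IsQuotientMeasure σ mG mS ν)
    (hp : p ≠ ∞) (hρ : ∀ x : X, Continuous fun s : S => ρ s x) {μ : ComplexMeasure G}
    {T : Lp X p ν →L[ℂ] Lp X p ν} (hT : IsIntegratedForm (inducedRep σ ρ p) μ p ν T)
    {L : Lp X p mG →L[ℂ] Lp X p mG} (hL : IsIntegratedForm leftRegular μ p mG L)
    {f : S → ℝ} (hf : Measurable f) (hf0 : ∀ s, 0 ≤ f s) (hf1 : ∫⁻ s, ‖f s‖ₑ ∂mS = 1)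
    {ξ : G ⧸ S → X} (hξ : StronglyMeasurable ξ) (hξp : MemLp ξ p ν) :
    eLpNorm (T (hξp.toLp ξ)) p ν ≤ ‖L‖ₑ * eLpNorm ξ p ν +
      (μ.variation Set.univ ^ (p.toReal - 1) * ∫⁻ x, ∫⁻ k, ‖inducedRep σ ρ p k ξ x‖ₑ ^ p.toReal *
        ∫⁻ s, ‖f (σ.tau₂ k x * s) - f s‖ₑ ∂mS ∂μ.variation ∂ν) ^ (1 / p.toReal) := by
  have := hν.sigmaFinite
  have hq := one_le_toReal hp
  have hq0 : 0 < p.toReal := by linarith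
  set q := p.toReal with hqdef
  have hπ := isMeasurableIsometric_inducedRep hν hp hρ
  set φ : S → ℝ := fun s => f s ^ (1 / q) with hφdef
  have hφ : Measurable φ := hf.pow_const _
  have hφ1 : ∫⁻ s, ‖φ s‖ₑ ^ q ∂mS = 1 := by
    rw [← hf1]
    exact lintegral_congr fun s => enorm_rpow_inv_rpow hq (hf0 s)
  have hFm := stronglyMeasurable_cutoffExtension (σ := σ) (p := p) hρ hφ hξ
  have hFnorm : eLpNorm (cutoffExtension σ ρ p φ ξ) p mG = eLpNorm ξ p ν :=
    eLpNorm_eq_of_lintegral_rpow_eq hp (lintegral_cutoffExtension hν hp hρ hφ hφ1 hξ)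
  have hF : MemLp (cutoffExtension σ ρ p φ ξ) p mG :=
    ⟨hFm.aestronglyMeasurable, hFnorm ▸ hξp.2⟩
  set A : (G ⧸ S) × S → X := cutoffIntegral σ ρ p μ φ ξ with hA
  set B : (G ⧸ S) × S → X :=
    fun z => (φ z.2 : ℂ) • cintegral μ fun k => inducedRep σ ρ p k ξ z.1 with hB
  have hAm : StronglyMeasurable A :=
    stronglyMeasurable_cintegral μ (stronglyMeasurable_cutoffIntegrand hν hp hρ hφ hξ)
  have hcm : StronglyMeasurable fun x => cintegral μ fun k => inducedRep σ ρ p k ξ x :=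
    stronglyMeasurable_cintegral μ (hπ.stronglyMeasurable ξ hξ)
  have hBm : StronglyMeasurable B :=
    (Complex.measurable_ofReal.comp (hφ.comp measurable_snd)).stronglyMeasurable.smul
      (hcm.comp_measurable measurable_fst)
  have hAL := ae_cutoffIntegral hν hp hL hF
  have hAnorm : eLpNorm A p (ν.prod mS) = eLpNorm (L (hF.toLp _)) p mG := by
    refine eLpNorm_eq_of_lintegral_rpow_eq hp ?_
    rw [lintegral_prod _ (hAm.enorm.pow_const _).aemeasurable,
      hν.lintegral_eq _ ((Lp.stronglyMeasurable _).enorm.pow_const _)]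
    refine lintegral_congr_ae ?_
    filter_upwards [hAL] with x hx
    refine lintegral_congr_ae ?_
    filter_upwards [hx] with s hs
    exact hs.2.symm
  have hBnorm : eLpNorm B p (ν.prod mS) = eLpNorm (T (hξp.toLp ξ)) p ν := by
    refine eLpNorm_eq_of_lintegral_rpow_eq hp ?_
    rw [lintegral_prod _ (hBm.enorm.pow_const _).aemeasurable]
    refine lintegral_congr_ae ?_
    filter_upwards [hT ξ hξp] with x hx
    rw [hx.2]
    have h1 : ∀ s, ‖B (x, s)‖ₑ ^ q =
        ‖φ s‖ₑ ^ q * ‖cintegral μ fun k => inducedRep σ ρ p k ξ x‖ₑ ^ q := fun s => by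
      rw [hB, enorm_smul, ENNReal.mul_rpow_of_nonneg _ _ hq0.le, ← ofReal_norm, Complex.norm_real,
        ofReal_norm]
    simp_rw [← hqdef, h1]
    rw [lintegral_mul_const _ (hφ.enorm.pow_const _), hφ1, one_mul]
  have hdiff : eLpNorm (B - A) p (ν.prod mS) ≤ (μ.variation Set.univ ^ (q - 1) *
      ∫⁻ x, ∫⁻ k, ‖inducedRep σ ρ p k ξ x‖ₑ ^ q *
        ∫⁻ s, ‖f (σ.tau₂ k x * s) - f s‖ₑ ∂mS ∂μ.variation ∂ν) ^ (1 / q) := by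
    rw [one_div, ENNReal.le_rpow_inv_iff hq0, hqdef, eLpNorm_rpow_toReal hp,
      lintegral_prod _ ((hBm.sub hAm).enorm.pow_const _).aemeasurable, ← hqdef,
      ← lintegral_const_mul' _ _
        (ENNReal.rpow_lt_top_of_nonneg (by linarith) (measure_ne_top _ _)).ne]
    refine lintegral_mono_ae ?_
    filter_upwards [hAL, hT ξ hξp] with x hx hTx
    calc ∫⁻ s, ‖(B - A) (x, s)‖ₑ ^ q ∂mS
        ≤ ∫⁻ s, μ.variation Set.univ ^ (q - 1) * ∫⁻ k, ‖f (σ.tau₂ k x * s) - f s‖ₑ *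
            ‖inducedRep σ ρ p k ξ x‖ₑ ^ q ∂μ.variation ∂mS := by
          refine lintegral_mono_ae ?_
          filter_upwards [hx] with s hs
          exact enorm_smul_cintegral_sub_cutoffIntegral_rpow_le hp μ hf0 hTx.1 hs.1
      _ = _ := by
          rw [lintegral_const_mul' _ _
            (ENNReal.rpow_lt_top_of_nonneg (by linarith) (measure_ne_top _ _)).ne]
          congr 1
          have hτ : Measurable fun k => σ.tau₂ k x :=
            σ.measurable_tau₂.comp (measurable_prodMk_left (x := x))
          have hτm := (hτ.comp measurable_snd).mul (measurable_fst (α := S) (β := G))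
          have hm1 := ((hf.comp hτm).sub (hf.comp measurable_fst)).enorm
          have hm2 := ((hπ.stronglyMeasurable ξ hξ).comp_measurable
            (measurable_prodMk_left (x := x))).enorm.pow_const q
          have hm3 := hm1.mul (hm2.comp measurable_snd)
          rw [lintegral_lintegral_swap hm3.aemeasurable]
          refine lintegral_congr fun k => ?_
          rw [lintegral_mul_const, mul_comm]
          exact ((hf.comp (measurable_const_mul _)).sub hf).enorm
  calc eLpNorm (T (hξp.toLp ξ)) p ν = eLpNorm (A + (B - A)) p (ν.prod mS) := by
        rw [← hBnorm, add_sub_cancel]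
    _ ≤ eLpNorm A p (ν.prod mS) + eLpNorm (B - A) p (ν.prod mS) :=
        eLpNorm_add_le hAm.aestronglyMeasurable (hBm.sub hAm).aestronglyMeasurable hp1.out
    _ ≤ _ := by
        refine add_le_add ?_ hdiff
        rw [hAnorm]
        refine (eLpNorm_clm_le L _).trans_eq ?_
        rw [eLpNorm_congr_ae hF.coeFn_toLp, hFnorm]

/-- Transference: the integrated form of an induced representation is dominated by that of the
left-regular representation. -/
theorem norm_le_of_isIntegratedForm [CompleteSpace X] (hS : IsAmenable S)
    (hν : IsQuotientMeasure σ mG mS ν)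
    (hp : p ≠ ∞) (hρ : ∀ x : X, Continuous fun s : S => ρ s x) {μ : ComplexMeasure G}
    {T : Lp X p ν →L[ℂ] Lp X p ν} (hT : IsIntegratedForm (inducedRep σ ρ p) μ p ν T)
    {L : Lp X p mG →L[ℂ] Lp X p mG} (hL : IsIntegratedForm leftRegular μ p mG L) :
    ‖T‖ ≤ ‖L‖ := by
  have := hν.sigmaFinite
  have hq := one_le_toReal hp
  have hq0 : 0 < p.toReal := by linarith
  refine T.opNorm_le_bound (norm_nonneg _) fun u => ?_
  have hu := Lp.memLp u
  have hum := Lp.stronglyMeasurable u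
  set I := μ.variation Set.univ * ∫⁻ x, ‖u x‖ₑ ^ p.toReal ∂ν with hI
  have hItop : I ≠ ∞ :=
    ENNReal.mul_ne_top (measure_ne_top _ _) (lintegral_rpow_lt_top_of_memLp hp hu).ne
  set M := μ.variation Set.univ ^ (p.toReal - 1) with hM
  have hMtop : M ≠ ∞ :=
    (ENNReal.rpow_lt_top_of_nonneg (by linarith) (measure_ne_top _ _)).ne
  -- The compact set is chosen from `u` and `μ`, and only then the Reiter function. The `2` is the
  -- trivial bound for the distance to a translate, used off the compact set.
  have key : ∀ ε : ℝ, 0 < ε → eLpNorm (T u) p ν ≤ ‖L‖ₑ * eLpNorm u p ν +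
      (M * ((I + 2) * ENNReal.ofReal ε)) ^ (1 / p.toReal) := by
    intro ε hε
    obtain ⟨C, hC, hCε⟩ := exists_isCompact_lintegral_flow_le hν hp hρ μ.variation hum hu
      (ENNReal.ofReal_pos.2 hε).ne'
    obtain ⟨f, hf, hf0, hf1, hfε⟩ := exists_reiter mS hS hC hε
    have h1 := enorm_le_of_isIntegratedForm hν hp hρ hT hL hf hf0 hf1 hum hu
    rw [Lp.toLp_coeFn] at h1
    refine h1.trans (add_le_add_right (ENNReal.rpow_le_rpow (mul_le_mul_right ?_ _)
      (by positivity)) _)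
    refine hCε (fun t => ∫⁻ s, ‖f (t * s) - f s‖ₑ ∂mS) 2 ?_
      (lintegral_enorm_translate_sub_le_two hf hf1) hfε
    exact Measurable.lintegral_prod_right'
      ((hf.comp measurable_mul).sub (hf.comp measurable_snd)).enorm
  have hlim : Filter.Tendsto (fun ε : ℝ => ‖L‖ₑ * eLpNorm u p ν +
      (M * ((I + 2) * ENNReal.ofReal ε)) ^ (1 / p.toReal)) (nhdsWithin 0 (Set.Ioi 0))
      (nhds (‖L‖ₑ * eLpNorm u p ν)) := by
    have h0 : Filter.Tendsto (fun ε : ℝ => ENNReal.ofReal ε) (nhdsWithin 0 (Set.Ioi 0))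
        (nhds 0) := by
      have := (ENNReal.continuous_ofReal.tendsto 0).mono_left
        (nhdsWithin_le_nhds (s := Set.Ioi (0 : ℝ)))
      rwa [ENNReal.ofReal_zero] at this
    have h2 := ENNReal.Tendsto.const_mul (a := M) (ENNReal.Tendsto.const_mul (a := I + 2) h0
      (Or.inr (ENNReal.add_ne_top.2 ⟨hItop, ENNReal.ofNat_ne_top⟩))) (Or.inr hMtop)
    have h3 := ((ENNReal.continuous_rpow_const (y := 1 / p.toReal)).tendsto _).comp h2
    rw [mul_zero, mul_zero, ENNReal.zero_rpow_of_pos (by positivity)] at h3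
    have h4 := h3.const_add (‖L‖ₑ * eLpNorm u p ν)
    rwa [add_zero] at h4
  have hfinal : eLpNorm (T u) p ν ≤ ‖L‖ₑ * eLpNorm u p ν :=
    ge_of_tendsto hlim (Filter.eventually_of_mem self_mem_nhdsWithin fun ε hε => key ε hε)
  rw [← Lp.enorm_def, ← Lp.enorm_def] at hfinal
  rw [← toReal_enorm, ← toReal_enorm, ← toReal_enorm, ← ENNReal.toReal_mul]
  exact ENNReal.toReal_mono (ENNReal.mul_ne_top enorm_ne_top enorm_ne_top) hfinal

end TransferenceBound

/-! ### Amplification of scalar operators to `L^p(Ω)`-valued functions. -/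

section Amplification

variable {α : Type*} [MeasurableSpace α] {m : Measure α} {p : ℝ≥0∞} [hp1 : Fact (1 ≤ p)]

/-- The elementary tensor of a scalar function and a vector, as a vector-valued function. -/
def pureTensor {E : Type*} [NormedAddCommGroup E] [NormedSpace ℂ E] (y : E) (a : Lp ℂ p m) :
    Lp E p m :=
  (ContinuousLinearMap.toSpanSingleton ℂ y).compLpL p m a

theorem coeFn_pureTensor {E : Type*} [NormedAddCommGroup E] [NormedSpace ℂ E] (y : E)
    (a : Lp ℂ p m) : pureTensor y a =ᵐ[m] fun x => a x • y :=
  ContinuousLinearMap.coeFn_compLpL _ a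

/-- Indicators times vectors are pure tensors, and simple functions are dense because `p` is finite.
Scalars from the span are absorbed into the `L^p` factor. -/
theorem dense_sum_pureTensor {E : Type*} [NormedAddCommGroup E] [NormedSpace ℂ E] (hp : p ≠ ∞)
    {P : Lp E p m → Prop} (hclosed : IsClosed {u | P u})
    (h : ∀ (n : ℕ) (y : Fin n → E) (a : Fin n → Lp ℂ p m), P (∑ i, pureTensor (y i) (a i)))
    (u : Lp E p m) : P u := by
  have htop : ∀ u : Lp E p m, u ∈ (Submodule.span ℂ
      (Set.range fun z : E × Lp ℂ p m => pureTensor z.1 z.2)).topologicalClosure := by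
    refine Lp.induction hp _ ?_ ?_ (Submodule.isClosed_topologicalClosure _)
    · intro c s hs hμs
      refine Submodule.le_topologicalClosure _ (Submodule.subset_span
        ⟨(c, indicatorConstLp p hs hμs.ne 1), ?_⟩)
      rw [Lp.simpleFunc.coe_indicatorConst]
      apply Lp.ext
      filter_upwards [coeFn_pureTensor c (indicatorConstLp p hs hμs.ne (1 : ℂ)),
        indicatorConstLp_coeFn (p := p) (hs := hs) (hμs := hμs.ne) (c := (1 : ℂ)),
        indicatorConstLp_coeFn (p := p) (hs := hs) (hμs := hμs.ne) (c := c)] with x h1 h2 h3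
      rw [h1, h2, h3]
      by_cases hx : x ∈ s <;> simp [hx]
    · intro f g hf hg _ h1 h2
      exact Submodule.add_mem _ h1 h2
  refine closure_minimal ?_ hclosed (htop u)
  intro v hv
  obtain ⟨n, c, g, rfl⟩ := Submodule.mem_span_set'.1 hv
  choose z hz using fun i => (g i).2
  have h1 := h n (fun i => (z i).1) (fun i => c i • (z i).2)
  have h2 : ∀ i, pureTensor (z i).1 (c i • (z i).2) = c i • (g i : Lp E p m) := fun i => by
    rw [← hz i]
    exact map_smul _ _ _
  simp_rw [h2] at h1
  exact h1

theorem enorm_sum_smul_rpow (hp : p ≠ ∞) {n : ℕ} (c : Fin n → ℂ) (y : Fin n → Lp ℂ p m) :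
    ‖∑ i, c i • y i‖ₑ ^ p.toReal = ∫⁻ x, ‖∑ i, c i * y i x‖ₑ ^ p.toReal ∂m := by
  rw [Lp.enorm_def, eLpNorm_rpow_toReal hp]
  refine lintegral_congr_ae ?_
  filter_upwards [Lp.coeFn_finsetSum Finset.univ fun i => c i • y i,
    ae_all_iff.2 fun i => Lp.coeFn_smul (c i) (y i)] with x h1 h2
  rw [h1, Finset.sum_apply]
  simp only [h2, Pi.smul_apply, smul_eq_mul]

theorem lintegral_enorm_sum_smul_rpow_comm [SFinite m] {Ω : Type*} [MeasurableSpace Ω]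
    (ω : Measure Ω) (hp : p ≠ ∞) {n : ℕ} (a : Fin n → Lp ℂ p m) (y : Fin n → Lp ℂ p ω) :
    ∫⁻ x, ‖∑ i, a i x • y i‖ₑ ^ p.toReal ∂m = ∫⁻ t, ‖∑ i, y i t • a i‖ₑ ^ p.toReal ∂ω := by
  have hq := one_le_toReal hp
  have hq0 : 0 < p.toReal := by linarith
  -- The measure on `Ω` is arbitrary, but finitely many `L^p` functions vanish off a common set on
  -- which it is σ-finite; Tonelli is applied there.
  obtain ⟨t₀, ht₀, h0, hfin⟩ := (((memLp_finsetSum Finset.univ (f := fun i t => ‖y i t‖)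
    fun i _ => (Lp.memLp (y i)).norm).finStronglyMeasurable_of_stronglyMeasurable
    (Finset.stronglyMeasurable_fun_sum Finset.univ fun i _ => (Lp.stronglyMeasurable (y i)).norm)
    (zero_lt_one.trans_le hp1.out).ne' hp)).exists_set_sigmaFinite
  have hy0 : ∀ t ∉ t₀, ∀ i, y i t = 0 := fun t ht i => by
    have := (Finset.sum_eq_zero_iff_of_nonneg fun i _ => norm_nonneg (y i t)).1 (h0 t ht) i
      (Finset.mem_univ i)
    exact norm_eq_zero.1 this
  have hrestrict : ∀ F : Ω → ℝ≥0∞, (∀ t ∉ t₀, F t = 0) → ∫⁻ t, F t ∂ω = ∫⁻ t in t₀, F t ∂ω :=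
    fun F hF => (setLIntegral_eq_of_support_subset fun t ht => by
      by_contra h; exact ht (hF t h)).symm
  simp_rw [enorm_sum_smul_rpow hp]
  rw [hrestrict]
  · have h1 : ∀ x, ∫⁻ t, ‖∑ i, a i x * y i t‖ₑ ^ p.toReal ∂ω =
        ∫⁻ t in t₀, ‖∑ i, y i t * a i x‖ₑ ^ p.toReal ∂ω := fun x => by
      rw [hrestrict]
      · simp_rw [mul_comm]
      · intro t ht
        simp [hy0 t ht, hq0]
    simp_rw [h1]
    refine lintegral_lintegral_swap (Measurable.aemeasurable ?_)
    refine Measurable.pow_const (Measurable.enorm (Finset.measurable_sum _ fun i _ => ?_)) _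
    exact ((Lp.stronglyMeasurable (y i)).measurable.comp measurable_snd).mul
      ((Lp.stronglyMeasurable (a i)).measurable.comp measurable_fst)
  · intro t ht
    simp [hy0 t ht, hq0]

theorem enorm_sum_pureTensor_rpow [SFinite m] {Ω : Type*} [MeasurableSpace Ω]
    {ω : Measure Ω} (hp : p ≠ ∞) {n : ℕ} (a : Fin n → Lp ℂ p m) (y : Fin n → Lp ℂ p ω) :
    ‖∑ i, pureTensor (y i) (a i)‖ₑ ^ p.toReal = ∫⁻ t, ‖∑ i, y i t • a i‖ₑ ^ p.toReal ∂ω := by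
  rw [← lintegral_enorm_sum_smul_rpow_comm ω hp, Lp.enorm_def, eLpNorm_rpow_toReal hp]
  refine lintegral_congr_ae ?_
  filter_upwards [Lp.coeFn_finsetSum Finset.univ fun i => pureTensor (y i) (a i),
    ae_all_iff.2 fun i => coeFn_pureTensor (y i) (a i)] with x h1 h2
  rw [h1, Finset.sum_apply]
  simp only [h2]

/-- An operator on `L^p(α, L^p(Ω))` acting as `L₀ ⊗ 1` has norm at most that of `L₀`. -/
theorem norm_le_of_pureTensor [SFinite m] {Ω : Type*} [MeasurableSpace Ω] {ω : Measure Ω}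
    (hp : p ≠ ∞) {L : Lp (Lp ℂ p ω) p m →L[ℂ] Lp (Lp ℂ p ω) p m}
    {L₀ : Lp ℂ p m →L[ℂ] Lp ℂ p m}
    (h : ∀ y a, L (pureTensor y a) = pureTensor y (L₀ a)) : ‖L‖ ≤ ‖L₀‖ := by
  have hq := one_le_toReal hp
  have hq0 : 0 < p.toReal := by linarith
  refine L.opNorm_le_bound (norm_nonneg _) fun u => ?_
  refine dense_sum_pureTensor (P := fun u => ‖L u‖ ≤ ‖L₀‖ * ‖u‖) hp
    (isClosed_le (by fun_prop) (by fun_prop)) (fun n y a => ?_) u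
  have key : ‖L (∑ i, pureTensor (y i) (a i))‖ₑ ≤ ‖L₀‖ₑ * ‖∑ i, pureTensor (y i) (a i)‖ₑ := by
    rw [← ENNReal.rpow_le_rpow_iff hq0, ENNReal.mul_rpow_of_nonneg _ _ hq0.le, map_sum]
    simp_rw [h]
    rw [enorm_sum_pureTensor_rpow hp, enorm_sum_pureTensor_rpow hp, ← lintegral_const_mul' _ _
      (ENNReal.rpow_lt_top_of_nonneg hq0.le enorm_ne_top).ne]
    refine lintegral_mono fun t => ?_
    rw [← ENNReal.mul_rpow_of_nonneg _ _ hq0.le]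
    refine ENNReal.rpow_le_rpow ?_ hq0.le
    -- For fixed `t` the coefficients `y i t` are scalars, so the combination of the `L₀ (a i)` is
    -- `L₀` applied to a single scalar function.
    refine le_trans (le_of_eq ?_) (L₀.le_opENorm _)
    simp only [map_sum, map_smul]
  rw [← toReal_enorm, ← toReal_enorm, ← toReal_enorm, ← ENNReal.toReal_mul]
  exact ENNReal.toReal_mono (ENNReal.mul_ne_top enorm_ne_top enorm_ne_top) key

/-- The bounded linear map `c ↦ c • y` commutes with translation of functions and with integration
against `μ`. -/
theorem leftRegular_pureTensor {G : Type*} [Group G] [MeasurableSpace G]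
    {E : Type*} [NormedAddCommGroup E] [NormedSpace ℂ E] [CompleteSpace E] {mG : Measure G}
    {μ : ComplexMeasure G} {L : Lp E p mG →L[ℂ] Lp E p mG}
    (hL : IsIntegratedForm leftRegular μ p mG L) {L₀ : Lp ℂ p mG →L[ℂ] Lp ℂ p mG}
    (hL₀ : IsIntegratedForm leftRegular μ p mG L₀) (y : E) (a : Lp ℂ p mG) :
    L (pureTensor y a) = pureTensor y (L₀ a) := by
  have hmem : MemLp (fun g => a g • y) p mG :=
    (ContinuousLinearMap.toSpanSingleton ℂ y).comp_memLp a
  have hto : hmem.toLp _ = pureTensor y a :=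
    Lp.ext (hmem.coeFn_toLp.trans (coeFn_pureTensor y a).symm)
  rw [← hto]
  apply Lp.ext
  filter_upwards [hL _ hmem, hL₀ a (Lp.memLp a), coeFn_pureTensor y (L₀ a)] with g h1 h2 h3
  rw [Lp.toLp_coeFn] at h2
  rw [h1.2, h3, h2.2]
  exact cintegral_comp_clm (ContinuousLinearMap.toSpanSingleton ℂ y) h2.1

end Amplification

end PInduced

end

/-! ### The main theorem. -/

theorem theorem3p4 {G : Type*} [Group G] [TopologicalSpace G] [IsTopologicalGroup G]
    [LocallyCompactSpace G] [T2Space G] [SecondCountableTopology G]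
    [MeasurableSpace G] [BorelSpace G]
    (S : Subgroup G) [IsClosed (S : Set G)] (hS : PInduced.IsAmenable S)
    (mG : Measure G) [mG.IsHaarMeasure] (mS : Measure S) [mS.IsHaarMeasure]
    (σ : PInduced.CrossSection S) (ν : Measure (G ⧸ S))
    (hν : PInduced.IsQuotientMeasure σ mG mS ν)
    (p : ℝ≥0∞) [Fact (1 ≤ p)] (hp : p ≠ ∞) (μ : ComplexMeasure G) :
    (∀ (X : Type*) [NormedAddCommGroup X] [NormedSpace ℂ X] [CompleteSpace X]
        (ρ : S →* (X ≃ₗᵢ[ℂ] X)), (∀ x : X, Continuous fun s : S => ρ s x) →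
        ∀ (X₀ : Submodule ℂ X) (i : X₀ →ₛₗ[starRingEnd ℂ] StrongDual ℂ X),
          PInduced.IsNormingEmbedding ρ X₀ i →
          ∃ (T : Lp X p ν →L[ℂ] Lp X p ν) (L : Lp X p mG →L[ℂ] Lp X p mG),
            PInduced.IsIntegratedForm (PInduced.inducedRep σ ρ p) μ p ν T ∧
            PInduced.IsIntegratedForm PInduced.leftRegular μ p mG L ∧
            ‖T‖ ≤ ‖L‖) ∧
    (∀ (Ω : Type*) [MeasurableSpace Ω] (ω : Measure Ω)
        (ρ : S →* (Lp ℂ p ω ≃ₗᵢ[ℂ] Lp ℂ p ω)), (∀ x : Lp ℂ p ω, Continuous fun s : S => ρ s x) →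
        ∀ (X₀ : Submodule ℂ (Lp ℂ p ω)) (i : X₀ →ₛₗ[starRingEnd ℂ] StrongDual ℂ (Lp ℂ p ω)),
          PInduced.IsNormingEmbedding ρ X₀ i →
          ∃ (T : Lp (Lp ℂ p ω) p ν →L[ℂ] Lp (Lp ℂ p ω) p ν)
            (L : Lp (Lp ℂ p ω) p mG →L[ℂ] Lp (Lp ℂ p ω) p mG)
            (L₀ : Lp ℂ p mG →L[ℂ] Lp ℂ p mG),
            PInduced.IsIntegratedForm (PInduced.inducedRep σ ρ p) μ p ν T ∧
            PInduced.IsIntegratedForm PInduced.leftRegular μ p mG L ∧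
            PInduced.IsIntegratedForm PInduced.leftRegular μ p mG L₀ ∧
            ‖T‖ ≤ ‖L‖ ∧ ‖L‖ ≤ ‖L₀‖) := by
  have := hν.sigmaFinite
  refine ⟨fun X _ _ _ ρ hρ _ _ _ => ?_, fun Ω _ ω ρ hρ _ _ _ => ?_⟩
  · have hT := (PInduced.isMeasurableIsometric_inducedRep hν hp hρ).isIntegratedForm hp μ
    have hL := (PInduced.isMeasurableIsometric_leftRegular (X := X) mG p).isIntegratedForm hp μ
    exact ⟨_, _, hT, hL, PInduced.norm_le_of_isIntegratedForm hS hν hp hρ hT hL⟩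
  · have hT := (PInduced.isMeasurableIsometric_inducedRep hν hp hρ).isIntegratedForm hp μ
    have hL := (PInduced.isMeasurableIsometric_leftRegular
      (X := Lp ℂ p ω) mG p).isIntegratedForm hp μ
    have hL₀ := (PInduced.isMeasurableIsometric_leftRegular (X := ℂ) mG p).isIntegratedForm hp μ
    exact ⟨_, _, _, hT, hL, hL₀, PInduced.norm_le_of_isIntegratedForm hS hν hp hρ hT hL,
      PInduced.norm_le_of_pureTensor hp (PInduced.leftRegular_pureTensor hL hL₀)⟩
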